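/- Let $p$ be a prime. For $p>2$ let $v\in\mathbb Q_p$ be a non-square with $|v|_p=1$, and let $\mathbb H_p$ be the quaternion algebra over $\mathbb Q_p$ with basis $1,\mathbf i,\mathbf j,\mathbf k$, where $\mathbf i^2=v$, $\mathbf j^2=-p$, $\mathbf k=\mathbf j\mathbf i=-\mathbf i\mathbf j$. For $p=2$ let $\mathbf i^2=\mathbf j^2=-1$, $\mathbf k=\mathbf i\mathbf j=-\mathbf j\mathbf i$. The reduced norm of $q_0+\mathbf i q_1+\mathbf j q_2+\mathbf k q_3$ is $$Q_{(4)}(q)=q_0^2-vq_1^2+pq_2^2-pvq_3^2\ (p>2),\qquad Q_{(4)}(q)=q_0^2+q_1^2+q_2^2+q_3^2\ (p=2).$$ Let $\mathbb P(\mathbb H_p^\times)=\{(\gamma,\delta)\in\mathbb H_p^\times\times\mathbb H_p^\times:\mathrm{nrd}(\gamma)=\mathrm{nrd}(\delta)\}$, with the subspace topology of $\mathbb Q_p^8$. For $\gamma=c_0+\mathbf i c_1+\mathbf j c_2+\mathbf k c_3$ and $\delta=d_0+\mathbf i d_1+\mathbf j d_2+\mathbf k d_3$ put $\varphi_0(\gamma,\delta)=(c_1,c_2,c_3,d_0,d_1,d_2,d_3)\in\mathbb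 Q_p^7$. For $y=(a_1,a_2,a_3,b_0,b_1,b_2,b_3)\in\mathbb Q_p^7$ put $$R(y)=Q_{(4)}(b_0,b_1,b_2,b_3)+va_1^2-pa_2^2+pva_3^2\ (p>2),\qquad R(y)=Q_{(4)}(b_0,b_1,b_2,b_3)-a_1^2-a_2^2-a_3^2\ (p=2).$$ Let $\lambda$ be the Haar measure on $\mathbb Q_p^7$ with $\lambda(\mathbb Z_p^7)=1$. Let $r=1$ if $p>2$ and $r=1/2$ if $p=2$; balls are taken in the maximum norm. (a) Let $\mathscr B$ be the set of elements of $\mathbb P(\mathbb H_p^\times)$ whose coordinates lie in the open ball of $\mathbb Q_p^8$ with centre $(1,0,0,0,1,0,0,0)$ and radius $r$. Then $\mathscr B$ is an open neighbourhood of the identity $e$, and $\varphi_0$ maps it homeomorphically onto the open ball of $\mathbb Q_p^7$ with centre $(0,0,0,1,0,0,0)$ and radius $r$. For every $g=(\gamma,\delta)\in\mathscr B$, $R(\varphi_0(g))$ is a square in $\mathbb Q_p$ and $c_0=\pm\sqrt{R(\varphi_0(g))}$. (b) There is a Haar measure $\mu$ on $\mathbb P(\mathbb H_p^\times)$, of which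 every other Haar measure is a positive multiple, such that for every open neighbourhood $\mathscr U_0$ of $e$ on which $\varphi_0$ is injective (for example $\mathscr U_0=\mathscr B$) and every Borel set $\mathcal E\subseteq\mathbb P(\mathbb H_p^\times)$, $$\mu(\mathcal E\cap\mathscr U_0)=\int_{\varphi_0(\mathcal E\cap\mathscr U_0)}\left|\sqrt{R(y)}\;Q_{(4)}(b_0,b_1,b_2,b_3)^3\right|_p^{-1}\,d\lambda(y),$$ that is, for $p>2$ with the density $\left|\sqrt{Q_{(4)}(b)+va_1^2-pa_2^2+pva_3^2}\,Q_{(4)}(b)^3\right|_p^{-1}$, and for $p=2$ with the density $\left|\sqrt{Q_{(4)}(b)-a_1^2-a_2^2-a_3^2}\,Q_{(4)}(b)^3\right|_2^{-1}$. (The absolute value does not depend on the choice of the square root.) -/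

import Mathlib

open MeasureTheory Topology

noncomputable section

namespace PadicQuat

/-! ### The Haar measures on `ℚ_p` and on `ℚ_p ^ n` -/

instance padicMeasurableSpace (p : ℕ) [Fact p.Prime] : MeasurableSpace ℚ_[p] := borel _

instance padicBorelSpace (p : ℕ) [Fact p.Prime] : BorelSpace ℚ_[p] := ⟨rfl⟩

/-- The closed unit ball `ℤ_p` of `ℚ_p`, a compact set with nonempty interior. -/
def unitBall (p : ℕ) [Fact p.Prime] : TopologicalSpace.PositiveCompacts ℚ_[p] where
  carrier := Metric.closedBall 0 1
  isCompact' := isCompact_closedBall 0 1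
  interior_nonempty' :=
    ⟨0, Metric.ball_subset_interior_closedBall (Metric.mem_ball_self one_pos)⟩

/-- The Haar measure on `(ℚ_p, +)`, normalized so that `ℤ_p` has measure `1`. -/
def padicHaar (p : ℕ) [Fact p.Prime] : Measure ℚ_[p] := Measure.addHaarMeasure (unitBall p)

/-- The Haar measure on `ℚ_p ^ n`: the `n`-fold product of the normalized one on `ℚ_p`. -/
def padicHaarPi (p : ℕ) [Fact p.Prime] (n : ℕ) : Measure (Fin n → ℚ_[p]) :=
  Measure.pi fun _ => padicHaar p

/-- A `p`-adic square root: some `r` with `r * r = x` if `x` is a square in `ℚ_p`, which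
determines `r` up to sign. The value at a non-square is irrelevant. -/
def padicSqrt (p : ℕ) [Fact p.Prime] (x : ℚ_[p]) : ℚ_[p] :=
  open scoped Classical in if h : IsSquare x then h.choose else 0

/-! ### Quaternion algebras over `ℚ_p` and the group of pairs of equal reduced norm

`QuaternionAlgebra ℚ_[p] a 0 b` has the basis `1, i, j, ij` with `i² = a`, `j² = b`,
`ji = -ij`, and `star` is the conjugation. -/

/-- The reduced norm `nrd ξ = ξ * star ξ`, a scalar, as a multiplicative map. -/
def nrd (p : ℕ) [Fact p.Prime] (a b : ℚ_[p]) : QuaternionAlgebra ℚ_[p] a 0 b →* ℚ_[p] where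
  toFun x := (x * star x).re
  map_one' := by simp
  map_mul' x y := by simp; ring

/-- The group `ℙ(ℍˣ)` of pairs of invertible quaternions of equal reduced norm. -/
def quatPairs (p : ℕ) [Fact p.Prime] (a b : ℚ_[p]) :
    Subgroup ((QuaternionAlgebra ℚ_[p] a 0 b)ˣ × (QuaternionAlgebra ℚ_[p] a 0 b)ˣ) where
  carrier := {g | nrd p a b g.1 = nrd p a b g.2}
  one_mem' := by simp
  mul_mem' {g h} hg hh := by
    simp only [Set.mem_ofPred_eq] at *
    simp [hg, hh]
  inv_mem' {g} hg := by
    have e : Units.map (nrd p a b) g.1 = Units.map (nrd p a b) g.2 := Units.ext hg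
    have e' := congrArg (fun u : (ℚ_[p])ˣ => ((u⁻¹ : (ℚ_[p])ˣ) : ℚ_[p])) e
    exact e'

/-- `ℙ(ℍˣ)` carries the subspace topology of `ℚ_p ^ 4 × ℚ_p ^ 4`. -/
instance quatPairsTopology (p : ℕ) [Fact p.Prime] (a b : ℚ_[p]) :
    TopologicalSpace (quatPairs p a b) :=
  TopologicalSpace.induced
    (fun g => (QuaternionAlgebra.equivTuple a 0 b (g.1.1 : QuaternionAlgebra ℚ_[p] a 0 b),
      QuaternionAlgebra.equivTuple a 0 b (g.1.2 : QuaternionAlgebra ℚ_[p] a 0 b)))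
    inferInstance

instance quatPairsMeasurableSpace (p : ℕ) [Fact p.Prime] (a b : ℚ_[p]) :
    MeasurableSpace (quatPairs p a b) := borel _

instance quatPairsBorelSpace (p : ℕ) [Fact p.Prime] (a b : ℚ_[p]) :
    BorelSpace (quatPairs p a b) := ⟨rfl⟩

/-! ### The case `p > 2`: `i² = v`, `j² = -p`, `k = ji` -/

/-- The algebra `ℍ_p` for `p > 2` (with `v` a non-square unit). -/
abbrev OddQuat (p : ℕ) [Fact p.Prime] (v : ℚ_[p]) : Type :=
  QuaternionAlgebra ℚ_[p] v 0 (-(p : ℚ_[p]))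

/-- The group `ℙ(ℍ_pˣ)` for `p > 2`. -/
abbrev OddPairs (p : ℕ) [Fact p.Prime] (v : ℚ_[p]) : Type :=
  quatPairs p v (-(p : ℚ_[p]))

/-- The coordinates `(q₀, q₁, q₂, q₃)` in the basis `1, i, j, k = ji`. The minus sign is there
because the field `imK` is the coordinate along `ij = -ji`. -/
def oddCoords (p : ℕ) [Fact p.Prime] (v : ℚ_[p]) (x : OddQuat p v) : Fin 4 → ℚ_[p] :=
  ![x.re, x.imI, x.imJ, -x.imK]

theorem oddCoords_spec (p : ℕ) [Fact p.Prime] (v : ℚ_[p]) (x : OddQuat p v) :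
    let i : OddQuat p v := ⟨0, 1, 0, 0⟩
    let j : OddQuat p v := ⟨0, 0, 1, 0⟩
    x = oddCoords p v x 0 • (1 : OddQuat p v) + oddCoords p v x 1 • i +
      oddCoords p v x 2 • j + oddCoords p v x 3 • (j * i) := by
  ext <;> simp [oddCoords]

/-- The quadratic form `Q₍₄₎` for `p > 2`. -/
def oddForm (p : ℕ) [Fact p.Prime] (v : ℚ_[p]) (q : Fin 4 → ℚ_[p]) : ℚ_[p] :=
  q 0 ^ 2 - v * q 1 ^ 2 + p * q 2 ^ 2 - p * v * q 3 ^ 2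

theorem nrd_eq_oddForm (p : ℕ) [Fact p.Prime] (v : ℚ_[p]) (x : OddQuat p v) :
    nrd p v (-(p : ℚ_[p])) x = oddForm p v (oddCoords p v x) := by
  simp [nrd, oddForm, oddCoords]; ring

/-- The coordinate map `φ₀(γ, δ) = (c₁, c₂, c₃, d₀, d₁, d₂, d₃)`. -/
def oddChart (p : ℕ) [Fact p.Prime] (v : ℚ_[p]) (g : OddPairs p v) : Fin 7 → ℚ_[p] :=
  let c := oddCoords p v g.1.1
  let d := oddCoords p v g.1.2
  ![c 1, c 2, c 3, d 0, d 1, d 2, d 3]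

/-- The elements `(γ, δ)` of the group in the open ball of `ℚ_p ^ 8` of centre
`(1,0,0,0,1,0,0,0)` and radius `1`. -/
def oddBall (p : ℕ) [Fact p.Prime] (v : ℚ_[p]) : Set (OddPairs p v) :=
  {g | (oddCoords p v g.1.1, oddCoords p v g.1.2) ∈
    Metric.ball ((![1, 0, 0, 0], ![1, 0, 0, 0]) : (Fin 4 → ℚ_[p]) × (Fin 4 → ℚ_[p])) 1}

/-- `Q₍₄₎(b₀,b₁,b₂,b₃) + v a₁² - p a₂² + p v a₃²` for `y = (a₁,a₂,a₃,b₀,b₁,b₂,b₃)`. -/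
def oddRadicand (p : ℕ) [Fact p.Prime] (v : ℚ_[p]) (y : Fin 7 → ℚ_[p]) : ℚ_[p] :=
  oddForm p v ![y 3, y 4, y 5, y 6] + v * y 0 ^ 2 - p * y 1 ^ 2 + p * v * y 2 ^ 2

/-! ### The case `p = 2`: `i² = j² = k² = -1`, `k = ij` -/

/-- The algebra `ℍ_2`. -/
abbrev TwoQuat : Type := QuaternionAlgebra ℚ_[2] (-1) 0 (-1)

/-- The group `ℙ(ℍ_2ˣ)`. -/
abbrev TwoPairs : Type := quatPairs 2 (-1) (-1)

/-- The coordinates `(q₀, q₁, q₂, q₃)` in the basis `1, i, j, k = ij`. -/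
def twoCoords (x : TwoQuat) : Fin 4 → ℚ_[2] := ![x.re, x.imI, x.imJ, x.imK]

theorem twoCoords_spec (x : TwoQuat) :
    let i : TwoQuat := ⟨0, 1, 0, 0⟩
    let j : TwoQuat := ⟨0, 0, 1, 0⟩
    x = twoCoords x 0 • (1 : TwoQuat) + twoCoords x 1 • i +
      twoCoords x 2 • j + twoCoords x 3 • (i * j) := by
  ext <;> simp [twoCoords]

/-- The quadratic form `Q₍₄₎` for `p = 2`. -/
def twoForm (q : Fin 4 → ℚ_[2]) : ℚ_[2] := q 0 ^ 2 + q 1 ^ 2 + q 2 ^ 2 + q 3 ^ 2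

theorem nrd_eq_twoForm (x : TwoQuat) : nrd 2 (-1) (-1) x = twoForm (twoCoords x) := by
  simp [nrd, twoForm, twoCoords]; ring

/-- The coordinate map `φ₀(γ, δ) = (c₁, c₂, c₃, d₀, d₁, d₂, d₃)`. -/
def twoChart (g : TwoPairs) : Fin 7 → ℚ_[2] :=
  let c := twoCoords g.1.1
  let d := twoCoords g.1.2
  ![c 1, c 2, c 3, d 0, d 1, d 2, d 3]

/-- The elements `(γ, δ)` of the group in the open ball of `ℚ_2 ^ 8` of centre
`(1,0,0,0,1,0,0,0)` and radius `1 / 2`. -/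
def twoBall : Set TwoPairs :=
  {g | (twoCoords g.1.1, twoCoords g.1.2) ∈
    Metric.ball ((![1, 0, 0, 0], ![1, 0, 0, 0]) : (Fin 4 → ℚ_[2]) × (Fin 4 → ℚ_[2])) (1 / 2)}

/-- `Q₍₄₎(b₀,b₁,b₂,b₃) - a₁² - a₂² - a₃²` for `y = (a₁,a₂,a₃,b₀,b₁,b₂,b₃)`. -/
def twoRadicand (y : Fin 7 → ℚ_[2]) : ℚ_[2] :=
  twoForm ![y 3, y 4, y 5, y 6] - y 0 ^ 2 - y 1 ^ 2 - y 2 ^ 2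

end PadicQuat

end

open PadicQuat

/-! The group G = ℙ(ℍˣ) is the level set nrd γ / nrd δ = 1 in ℍˣ × ℍˣ, and its Haar measure is
obtained from thin tubes around it. Left multiplication by x on ℍ has determinant nrd(x)², so near
the level set |nrd δ|⁻⁴ dγ dδ is invariant under G. The tube |nrd γ / nrd δ - 1| ≤ |e| is stable
under G, and dividing γ by the square root near 1 of the ratio, which exists by Hensel, is a
G-equivariant map of the tube to G. The image measure `tubeMeasure` is therefore left-invariant
(`isMulLeftInvariant_tubeMeasure`).

Take a small ball B of the chart and a branch of √R with |√R| = |c|, and let |Q(b)| = |n| on B.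
Since c₀² - R = nrd γ - nrd δ and |c₀² - R| = |2c| |c₀ - √R| near the branch, the part of the tube
over B consists of the points with c₀ in the closed ball of radius |e n / (2c)| about √R. With the
density |n|⁻⁴ its measure is exactly |e/2| · |c n³|⁻¹ λ(B) once e is small
(`tubeMeasure_chart_ball`); no limit in e is needed. The factor |e/2| is the same for all balls, so
uniqueness of Haar measure carries the normalization from one ball to every other
(`measure_chartBall_of_measure_chartBall`). On each such ball the claimed density is the constant |c
n³|⁻¹, and ultrametric balls determine a measure, which gives the integral formula
(`measure_inter_eq_lintegral`).

An open set on which φ₀ is injective contains no point with c₀ = 0 (`re_ne_zero_of_injOn`), so on it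
the inverse chart is locally given by the Hensel square root. Both cases of the theorem are
instances of one algebra i² = a, j² = b with |a|, |b| ≤ 1, a sign ε with k = ε ij, and the radius r
= |2|. -/

noncomputable section

namespace PadicQuat

open scoped ENNReal

/-! ### Haar measure on ℚ_p and ℚ_p ^ n: balls and linear changes of variables. -/

section PadicHaar

variable {p : ℕ} [Fact p.Prime]

instance : (padicHaar p).IsAddHaarMeasure := by
  unfold padicHaar; infer_instance

instance (n : ℕ) : (padicHaarPi p n).IsAddHaarMeasure := by
  unfold padicHaarPi; infer_instance

instance (n : ℕ) : SFinite (padicHaarPi p n) := by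
  unfold padicHaarPi; infer_instance

theorem padicHaar_closedBall_one (x : ℚ_[p]) : padicHaar p (Metric.closedBall x 1) = 1 := by
  have h : padicHaar p (Metric.closedBall 0 1) = 1 :=
    Measure.addHaarMeasure_self (K₀ := unitBall p)
  have := measure_preimage_add_right (padicHaar p) (-x) (Metric.closedBall 0 1)
  rw [h] at this
  rw [← this]
  congr 1
  ext y
  simp [dist_eq_norm, sub_eq_add_neg]

theorem padicHaar_closedBall_center (x : ℚ_[p]) (r : ℝ) :
    padicHaar p (Metric.closedBall x r) = padicHaar p (Metric.closedBall 0 r) := by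
  have := measure_preimage_add_right (padicHaar p) (-x) (Metric.closedBall 0 r)
  rw [← this]
  congr 1
  ext y
  simp [dist_eq_norm, sub_eq_add_neg]

/-- The centres are the residue classes modulo `p`, rescaled by `p ^ (-(n + 1))`. -/
theorem closedBall_zpow_succ_eq_iUnion (n : ℤ) :
    Metric.closedBall (0 : ℚ_[p]) ((p : ℝ) ^ (n + 1)) =
      ⋃ i ∈ Finset.range p,
        Metric.closedBall ((i : ℚ_[p]) * (p : ℚ_[p]) ^ (-(n + 1))) ((p : ℝ) ^ n) := by
  have hp : (p : ℚ_[p]) ≠ 0 := by exact_mod_cast (Fact.out : p.Prime).ne_zero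
  have hp' : (0 : ℝ) < p := by exact_mod_cast (Fact.out : p.Prime).pos
  ext x
  simp only [Metric.mem_closedBall, dist_eq_norm, sub_zero, Set.mem_iUnion, Finset.mem_range,
    exists_prop]
  constructor
  · intro hx
    have hn : ‖x * (p : ℚ_[p]) ^ (n + 1)‖ ≤ 1 := by
      rw [norm_mul, Padic.norm_p_zpow, zpow_neg]
      exact mul_inv_le_one_of_le₀ hx (by positivity)
    obtain ⟨z, hz⟩ : ∃ z : ℤ_[p], (z : ℚ_[p]) = x * (p : ℚ_[p]) ^ (n + 1) := ⟨⟨_, hn⟩, rfl⟩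
    obtain ⟨i, hi, hi'⟩ := PadicInt.exists_mem_range (p := p) z
    refine ⟨i, hi, ?_⟩
    rw [PadicInt.maximalIdeal_eq_span_p, ← pow_one (p : ℤ_[p]),
      ← PadicInt.norm_le_pow_iff_mem_span_pow] at hi'
    have e : x - i * (p : ℚ_[p]) ^ (-(n + 1)) =
        (x * (p : ℚ_[p]) ^ (n + 1) - i) * (p : ℚ_[p]) ^ (-(n + 1)) := by
      rw [sub_mul, mul_assoc, ← zpow_add₀ hp, add_neg_cancel, zpow_zero, mul_one]
    have hi2 : ‖x * (p : ℚ_[p]) ^ (n + 1) - i‖ ≤ (p : ℝ) ^ (-1 : ℤ) := by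
      rw [PadicInt.norm_def, PadicInt.coe_sub, PadicInt.coe_natCast, hz] at hi'
      exact hi'
    rw [e, norm_mul, Padic.norm_p_zpow, neg_neg]
    calc _ ≤ (p : ℝ) ^ (-1 : ℤ) * (p : ℝ) ^ (n + 1) := by gcongr
      _ = _ := by rw [← zpow_add₀ hp'.ne']; ring_nf
  · rintro ⟨i, _, hx⟩
    have h1 : (p : ℝ) ^ n ≤ (p : ℝ) ^ (n + 1) :=
      zpow_le_zpow_right₀ (by exact_mod_cast (Fact.out : p.Prime).one_le) (by omega)
    have h2 : ‖(i : ℚ_[p]) * (p : ℚ_[p]) ^ (-(n + 1))‖ ≤ (p : ℝ) ^ (n + 1) := by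
      rw [norm_mul, Padic.norm_p_zpow, neg_neg]
      have := Padic.norm_int_le_one (p := p) (i : ℤ)
      simp only [Int.cast_natCast] at this
      exact mul_le_of_le_one_left (by positivity) this
    have := IsUltrametricDist.norm_add_le_max (x - (i : ℚ_[p]) * (p : ℚ_[p]) ^ (-(n + 1)))
      ((i : ℚ_[p]) * (p : ℚ_[p]) ^ (-(n + 1)))
    rw [sub_add_cancel] at this
    exact this.trans (max_le (hx.trans h1) h2)

theorem padicHaar_closedBall_zpow_succ (n : ℤ) :
    padicHaar p (Metric.closedBall 0 ((p : ℝ) ^ (n + 1))) =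
      p * padicHaar p (Metric.closedBall 0 ((p : ℝ) ^ n)) := by
  have hp : (p : ℚ_[p]) ≠ 0 := by exact_mod_cast (Fact.out : p.Prime).ne_zero
  have hp' : (0 : ℝ) < p := by exact_mod_cast (Fact.out : p.Prime).pos
  rw [closedBall_zpow_succ_eq_iUnion, measure_biUnion_finset]
  · simp_rw [padicHaar_closedBall_center]
    simp
  · intro i hi j hj hij
    simp only [Finset.coe_range, Set.mem_Iio] at hi hj
    rw [Function.onFun, Set.disjoint_left]
    intro x hxi hxj
    apply hij
    rw [Metric.mem_closedBall, dist_eq_norm] at hxi hxj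
    have := IsUltrametricDist.norm_add_le_max (x - (j : ℚ_[p]) * (p : ℚ_[p]) ^ (-(n + 1)))
      (-(x - (i : ℚ_[p]) * (p : ℚ_[p]) ^ (-(n + 1))))
    rw [norm_neg] at this
    have h2 := this.trans (max_le hxj hxi)
    have e : x - (j : ℚ_[p]) * (p : ℚ_[p]) ^ (-(n + 1)) +
        (-(x - (i : ℚ_[p]) * (p : ℚ_[p]) ^ (-(n + 1)))) =
        ((i - j : ℤ) : ℚ_[p]) * (p : ℚ_[p]) ^ (-(n + 1)) := by push_cast; ring
    rw [e, norm_mul, Padic.norm_p_zpow, neg_neg] at h2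
    have h3 : ‖((i - j : ℤ) : ℚ_[p])‖ ≤ (p : ℝ) ^ (-(1 : ℕ) : ℤ) := by
      rw [← le_div_iff₀ (by positivity), ← zpow_sub₀ hp'.ne'] at h2
      rwa [show n - (n + 1) = -((1 : ℕ) : ℤ) by push_cast; ring] at h2
    rw [Padic.norm_int_le_pow_iff_dvd] at h3
    simp only [pow_one] at h3
    -- Both indices lie in `[0, p)`, so `p` divides their difference only if it vanishes.
    have := Int.eq_zero_of_abs_lt_dvd h3 (by rw [abs_lt]; constructor <;> omega)
    omega
  · intro i _
    exact Metric.isClosed_closedBall.measurableSet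

theorem padicHaar_closedBall_zpow (n : ℤ) :
    padicHaar p (Metric.closedBall 0 ((p : ℝ) ^ n)) = (p : ℝ≥0∞) ^ n := by
  have hp0 : (p : ℝ≥0∞) ≠ 0 := by exact_mod_cast (Fact.out : p.Prime).ne_zero
  have hpt : (p : ℝ≥0∞) ≠ ∞ := ENNReal.natCast_ne_top p
  induction n using Int.induction_on with
  | zero => simpa using padicHaar_closedBall_one (0 : ℚ_[p])
  | succ i ih =>
    rw [padicHaar_closedBall_zpow_succ, ih, ENNReal.zpow_add hp0 hpt, mul_comm, zpow_one]
  | pred i ih =>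
    have := padicHaar_closedBall_zpow_succ (p := p) (-i - 1)
    rw [sub_add_cancel, ih] at this
    rw [ENNReal.zpow_sub hp0 hpt, this, zpow_one, mul_comm, ← mul_assoc,
      ENNReal.inv_mul_cancel hp0 hpt, one_mul]

theorem padicHaar_closedBall (x : ℚ_[p]) {c : ℚ_[p]} (hc : c ≠ 0) :
    padicHaar p (Metric.closedBall x ‖c‖) = ‖c‖ₑ := by
  have hp' : (0 : ℝ) < p := by exact_mod_cast (Fact.out : p.Prime).pos
  rw [padicHaar_closedBall_center, ← ofReal_norm, Padic.norm_eq_zpow_neg_valuation hc,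
    padicHaar_closedBall_zpow, ENNReal.ofReal, Real.toNNReal_zpow hp'.le,
    ENNReal.coe_zpow (by simpa using hp'.ne'), ← ENNReal.ofReal, ENNReal.ofReal_natCast]

/-- The image is again a Haar measure, so its value on ℤ_p decides; the preimage of ℤ_p is the ball
of radius `‖c‖⁻¹`. -/
theorem map_mul_left_padicHaar {c : ℚ_[p]} (hc : c ≠ 0) :
    Measure.map (c * ·) (padicHaar p) = ‖c‖ₑ⁻¹ • padicHaar p := by
  have hK : Measure.IsAddHaarMeasure (Measure.map (c * ·) (padicHaar p)) :=
    AddEquiv.isAddHaarMeasure_map (padicHaar p)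
      (AddEquiv.mk' (Equiv.mulLeft₀ c hc) (mul_add c)) (continuous_const_mul c)
      (continuous_const_mul c⁻¹)
  have h := Measure.addHaarMeasure_unique (Measure.map (c * ·) (padicHaar p)) (unitBall p)
  rw [h]
  congr 1
  rw [Measure.map_apply (measurable_const_mul c) (unitBall p).isCompact.measurableSet]
  rw [← enorm_inv hc, ← padicHaar_closedBall 0 (inv_ne_zero hc)]
  congr 1
  ext y
  have : 0 < ‖c‖ := norm_pos_iff.2 hc
  show c * y ∈ Metric.closedBall 0 1 ↔ _
  simp [norm_inv, this, ← le_div_iff₀', one_div]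

variable {ι : Type*} [Fintype ι]

theorem map_diagonal_pi_padicHaar [DecidableEq ι] {D : ι → ℚ_[p]}
    (h : (Matrix.diagonal D).det ≠ 0) :
    Measure.map (Matrix.toLin' (Matrix.diagonal D)) (Measure.pi fun _ => padicHaar p) =
      ‖(Matrix.diagonal D).det‖ₑ⁻¹ • Measure.pi fun _ => padicHaar p := by
  rw [Matrix.det_diagonal] at h ⊢
  have hD : ∀ i, D i ≠ 0 := fun i => (Finset.prod_ne_zero_iff.1 h) i (Finset.mem_univ i)
  have hm : Measurable (Matrix.toLin' (Matrix.diagonal D)) :=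
    (Matrix.toLin' (Matrix.diagonal D)).continuous_of_finiteDimensional.measurable
  have hfin : ‖∏ i, D i‖ₑ⁻¹ ≠ ∞ := by simpa using h
  have h0 : ‖∏ i, D i‖ₑ ≠ 0 := by simpa using h
  -- The scalar is moved to the other side because `Measure.pi_eq` recognizes the product measure
  -- itself by its values on boxes.
  suffices H : (Measure.pi fun _ => padicHaar p) =
      ‖∏ i, D i‖ₑ • Measure.map (Matrix.toLin' (Matrix.diagonal D))
        (Measure.pi fun _ : ι => padicHaar p) by
    conv_rhs => rw [H]
    rw [smul_smul, ENNReal.inv_mul_cancel h0 enorm_ne_top, one_smul]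
  refine Measure.pi_eq fun s hs => ?_
  rw [Measure.smul_apply, Measure.map_apply hm (.univ_pi hs)]
  have e : Matrix.toLin' (Matrix.diagonal D) ⁻¹' Set.univ.pi s =
      Set.univ.pi fun i => (D i * ·) ⁻¹' s i := by
    ext x; simp [Matrix.mulVec_diagonal]
  have e2 : ∀ i, padicHaar p ((D i * ·) ⁻¹' s i) = ‖D i‖ₑ⁻¹ * padicHaar p (s i) := fun i => by
    rw [← Measure.map_apply (measurable_const_mul _) (hs i), map_mul_left_padicHaar (hD i)]; rfl
  rw [e, Measure.pi_pi]
  simp_rw [e2]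
  rw [Finset.prod_mul_distrib, smul_eq_mul, ← mul_assoc]
  have e3 : ‖∏ i, D i‖ₑ = ∏ i, ‖D i‖ₑ := by
    simp only [← ofReal_norm, norm_prod]
    exact ENNReal.ofReal_prod_of_nonneg fun i _ => norm_nonneg _
  rw [e3, ← Finset.prod_mul_distrib]
  simp [ENNReal.mul_inv_cancel, hD]

/-- A transvection translates every line in the direction `t.i`, so integrating along that
coordinate first reduces the claim to translation invariance. -/
theorem map_transvection_pi_padicHaar [DecidableEq ι] (t : Matrix.TransvectionStruct ι ℚ_[p]) :
    Measure.map (Matrix.toLin' t.toMatrix) (Measure.pi fun _ => padicHaar p) =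
      Measure.pi fun _ => padicHaar p := by
  have ht : Measurable (Matrix.toLin' t.toMatrix) :=
    (Matrix.toLin' t.toMatrix).continuous_of_finiteDimensional.measurable
  refine (Measure.pi_eq fun s hs ↦ ?_).symm
  have h2s : MeasurableSet (Set.univ.pi s) := .pi Set.countable_univ fun i _ ↦ hs i
  simp_rw [← Measure.pi_pi, ← lintegral_indicator_one h2s]
  rw [lintegral_map (measurable_one.indicator h2s) ht]
  refine lintegral_eq_of_lmarginal_eq {t.i} ((measurable_one.indicator h2s).comp ht)
    (measurable_one.indicator h2s) ?_
  simp_rw [lmarginal_singleton]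
  ext x
  cases t with | mk t_i t_j t_hij t_c =>
  simp [Matrix.transvection, Matrix.single_mulVec, t_hij.symm, ← Function.update_add,
    lintegral_add_right_eq_self fun xᵢ ↦ Set.indicator (Set.univ.pi s) 1 (Function.update x t_i xᵢ)]

/-- Diagonal matrices and transvections generate the invertible matrices, and both sides are
multiplicative in `M`. -/
theorem map_matrix_pi_padicHaar [DecidableEq ι] {M : Matrix ι ι ℚ_[p]} (hM : M.det ≠ 0) :
    Measure.map (Matrix.toLin' M) (Measure.pi fun _ => padicHaar p) =
      ‖M.det‖ₑ⁻¹ • Measure.pi fun _ => padicHaar p := by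
  apply Matrix.diagonal_transvection_induction_of_det_ne_zero _ M hM
  · intro D hD
    exact map_diagonal_pi_padicHaar hD
  · intro t
    rw [map_transvection_pi_padicHaar, Matrix.TransvectionStruct.det]
    simp
  · intro A B hA hB IHA IHB
    rw [Matrix.toLin'_mul, Matrix.det_mul, LinearMap.coe_comp, ← Measure.map_map, IHB,
      Measure.map_smul, IHA, smul_smul, enorm_mul,
      ENNReal.mul_inv (Or.inr enorm_ne_top) (Or.inl enorm_ne_top), mul_comm]
    · exact (LinearMap.continuous_on_pi _).measurable
    · exact (LinearMap.continuous_on_pi _).measurable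

end PadicHaar

/-! ### The branch of the p-adic square root near 1. -/

section SqrtNear

variable {p : ℕ} [Fact p.Prime]

theorem norm_eq_of_norm_sub_lt {x y : ℚ_[p]} (h : ‖x - y‖ < ‖y‖) : ‖x‖ = ‖y‖ := by
  have h1 := IsUltrametricDist.norm_add_eq_max_of_norm_ne_norm (x := x - y) (y := y) h.ne
  rwa [sub_add_cancel, max_eq_right h.le] at h1

theorem norm_two_le_one : ‖(2 : ℚ_[p])‖ ≤ 1 := by
  have := Padic.norm_int_le_one (p := p) 2
  simpa using this

theorem norm_two_pos : 0 < ‖(2 : ℚ_[p])‖ := norm_pos_iff.2 two_ne_zero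

theorem norm_four_eq : ‖(4 : ℚ_[p])‖ = ‖(2 : ℚ_[p])‖ * ‖(2 : ℚ_[p])‖ := by
  rw [← norm_mul]; norm_num

theorem norm_four_le_norm_two : ‖(4 : ℚ_[p])‖ ≤ ‖(2 : ℚ_[p])‖ := by
  rw [norm_four_eq]
  exact mul_le_of_le_one_left (norm_nonneg _) norm_two_le_one

theorem norm_two_mul_le (c : ℚ_[p]) : ‖2 * c‖ ≤ ‖c‖ := by
  rw [norm_mul]
  exact mul_le_of_le_one_left (norm_nonneg _) norm_two_le_one

theorem norm_eq_of_near {c x : ℚ_[p]} (hx : ‖x - c‖ < ‖2 * c‖) : ‖x‖ = ‖c‖ :=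
  norm_eq_of_norm_sub_lt (hx.trans_le (norm_two_mul_le c))

theorem norm_add_of_near {c x y : ℚ_[p]} (hx : ‖x - c‖ < ‖2 * c‖) (hy : ‖y - c‖ < ‖2 * c‖) :
    ‖x + y‖ = ‖2 * c‖ := by
  apply norm_eq_of_norm_sub_lt
  rw [show x + y - 2 * c = (x - c) + (y - c) by ring]
  exact (IsUltrametricDist.norm_add_le_max _ _).trans_lt (max_lt hx hy)

theorem norm_sq_sub_of_near {c x y : ℚ_[p]} (hx : ‖x - c‖ < ‖2 * c‖) (hy : ‖y - c‖ < ‖2 * c‖) :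
    ‖x ^ 2 - y ^ 2‖ = ‖2 * c‖ * ‖x - y‖ := by
  rw [sq_sub_sq, norm_mul, norm_add_of_near hx hy]

/-- The distance from `c` to `-c` is `‖2 * c‖`, so the open ball of this radius about `c` separates
the two square roots: the sum of two of its points has norm `‖2 * c‖`, which is not zero. -/
theorem eq_of_sq_eq_of_near {c x y : ℚ_[p]} (hx : ‖x - c‖ < ‖2 * c‖) (hy : ‖y - c‖ < ‖2 * c‖)
    (h : x ^ 2 = y ^ 2) : x = y := by
  have h1 := norm_sq_sub_of_near hx hy
  rw [h, sub_self, norm_zero, eq_comm, mul_eq_zero] at h1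
  rcases h1 with h1 | h1
  · rw [h1] at hx
    exact absurd hx (not_lt.2 (norm_nonneg _))
  · exact sub_eq_zero.1 (norm_eq_zero.1 h1)

/-- Hensel's lemma for `X ^ 2 - t` at the approximate root 1: its condition |F(1)| < |F'(1)|² is the
bound by `‖4‖`, uniformly in `p`, including `p = 2`. -/
theorem exists_sq_eq_of_near_one {t : ℚ_[p]} (ht : ‖t - 1‖ < ‖(4 : ℚ_[p])‖) :
    ∃ s : ℚ_[p], s ^ 2 = t ∧ ‖s - 1‖ < ‖(2 : ℚ_[p])‖ := by
  have ht1 : ‖t‖ ≤ 1 := by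
    have h1 : ‖t - 1‖ < ‖(1 : ℚ_[p])‖ := by
      rw [norm_one]
      exact ht.trans_le (norm_four_le_norm_two.trans norm_two_le_one)
    rw [norm_eq_of_norm_sub_lt h1, norm_one]
  obtain ⟨z, rfl⟩ : ∃ z : ℤ_[p], (z : ℚ_[p]) = t := ⟨⟨t, ht1⟩, rfl⟩
  have key := hensels_lemma (p := p) (F := (Polynomial.X ^ 2 - Polynomial.C z)) (a := 1)
  have e1 : ‖(1 : ℤ_[p]) - z‖ = ‖(z : ℚ_[p]) - 1‖ := by
    rw [norm_sub_rev, PadicInt.norm_def]; simp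
  have e2 : ‖(2 : ℤ_[p])‖ = ‖(2 : ℚ_[p])‖ := by
    rw [PadicInt.norm_def]; rfl
  simp only [map_sub, map_pow, Polynomial.aeval_X, Polynomial.aeval_C, one_pow,
    Polynomial.derivative_X_pow, Polynomial.derivative_C, sub_zero,
    map_mul, Algebra.algebraMap_self, RingHom.id_apply, e1] at key
  norm_num [e2] at key
  obtain ⟨s, hs, hs1, -⟩ := key (by rw [sq, ← norm_four_eq]; exact ht)
  refine ⟨s, ?_, ?_⟩
  · rw [sub_eq_zero] at hs
    rw [← hs]; simp
  · rw [PadicInt.norm_def] at hs1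
    simpa using hs1

/-- The square root close to `1` of a `p`-adic number close to `1`. -/
def sqrtNear (t : ℚ_[p]) : ℚ_[p] :=
  open scoped Classical in
  if h : ‖t - 1‖ < ‖(4 : ℚ_[p])‖ then (exists_sq_eq_of_near_one h).choose else 1

theorem sqrtNear_sq {t : ℚ_[p]} (ht : ‖t - 1‖ < ‖(4 : ℚ_[p])‖) : sqrtNear t ^ 2 = t := by
  rw [sqrtNear, dif_pos ht]
  exact (exists_sq_eq_of_near_one ht).choose_spec.1

theorem norm_sqrtNear_sub_one_lt (t : ℚ_[p]) : ‖sqrtNear t - 1‖ < ‖(2 : ℚ_[p])‖ := by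
  by_cases ht : ‖t - 1‖ < ‖(4 : ℚ_[p])‖
  · rw [sqrtNear, dif_pos ht]
    exact (exists_sq_eq_of_near_one ht).choose_spec.2
  · rw [sqrtNear, dif_neg ht, sub_self, norm_zero]
    exact norm_two_pos

theorem norm_sqrtNear (t : ℚ_[p]) : ‖sqrtNear t‖ = 1 := by
  rw [← norm_one (α := ℚ_[p])]
  apply norm_eq_of_near
  simpa using norm_sqrtNear_sub_one_lt t

theorem sqrtNear_ne_zero (t : ℚ_[p]) : sqrtNear t ≠ 0 := by
  rw [← norm_ne_zero_iff, norm_sqrtNear]; exact one_ne_zero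

theorem norm_two_mul_sqrtNear_sub {t u : ℚ_[p]} (ht : ‖t - 1‖ < ‖(4 : ℚ_[p])‖)
    (hu : ‖u - 1‖ < ‖(4 : ℚ_[p])‖) :
    ‖(2 : ℚ_[p])‖ * ‖sqrtNear t - sqrtNear u‖ = ‖t - u‖ := by
  have h := norm_sq_sub_of_near (c := (1 : ℚ_[p])) (x := sqrtNear t) (y := sqrtNear u)
    (by simpa using norm_sqrtNear_sub_one_lt t) (by simpa using norm_sqrtNear_sub_one_lt u)
  rw [sqrtNear_sq ht, sqrtNear_sq hu, mul_one] at h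
  exact h.symm

theorem norm_sqrtNear_sub_one {t : ℚ_[p]} (ht : ‖t - 1‖ < ‖(4 : ℚ_[p])‖) :
    ‖(2 : ℚ_[p])‖ * ‖sqrtNear t - 1‖ = ‖t - 1‖ := by
  have h := norm_sq_sub_of_near (c := (1 : ℚ_[p])) (x := sqrtNear t) (y := 1)
    (by simpa using norm_sqrtNear_sub_one_lt t) (by simp)
  rw [sqrtNear_sq ht, mul_one, one_pow] at h
  exact h.symm

/-- The ball of radius `‖4‖` is clopen and the function is constant outside it; inside, it
multiplies distances by `‖2‖⁻¹`. -/
theorem continuous_sqrtNear : Continuous (sqrtNear : ℚ_[p] → ℚ_[p]) := by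
  rw [continuous_iff_continuousAt]
  intro t
  have hc : IsClopen (Metric.ball (1 : ℚ_[p]) ‖(4 : ℚ_[p])‖) := IsUltrametricDist.isClopen_ball _ _
  by_cases ht : t ∈ Metric.ball (1 : ℚ_[p]) ‖(4 : ℚ_[p])‖
  · have ht' : ‖t - 1‖ < ‖(4 : ℚ_[p])‖ := by simpa [dist_eq_norm] using ht
    rw [Metric.continuousAt_iff']
    intro δ hδ
    have h1 : ∀ᶠ u in 𝓝 t, dist u t < ‖(2 : ℚ_[p])‖ * δ :=
      Metric.ball_mem_nhds t (mul_pos norm_two_pos hδ)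
    filter_upwards [hc.isOpen.mem_nhds ht, h1] with u hu hu1
    rw [dist_eq_norm] at hu1 ⊢
    rw [mem_ball_iff_norm] at hu
    rw [← norm_two_mul_sqrtNear_sub hu ht'] at hu1
    exact lt_of_mul_lt_mul_left hu1 norm_two_pos.le
  · have : sqrtNear =ᶠ[𝓝 t] fun _ => (1 : ℚ_[p]) := by
      filter_upwards [hc.compl.isOpen.mem_nhds ht] with u hu
      rw [sqrtNear, dif_neg]
      simpa [dist_eq_norm] using hu
    exact continuousAt_const.congr this.symm

theorem padicSqrt_sq {x : ℚ_[p]} (h : IsSquare x) : padicSqrt p x ^ 2 = x := by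
  rw [padicSqrt, dif_pos h, sq]
  exact h.choose_spec.symm

theorem eq_or_eq_neg_padicSqrt {x c : ℚ_[p]} (h : c ^ 2 = x) :
    IsSquare x ∧ (c = padicSqrt p x ∨ c = -padicSqrt p x) := by
  have hs : IsSquare x := ⟨c, by rw [← h, sq]⟩
  refine ⟨hs, sq_eq_sq_iff_eq_or_eq_neg.1 ?_⟩
  rw [h, padicSqrt_sq hs]

theorem norm_padicSqrt {x c : ℚ_[p]} (h : c ^ 2 = x) : ‖padicSqrt p x‖ = ‖c‖ := by
  rcases (eq_or_eq_neg_padicSqrt h).2 with h | h <;> rw [h]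
  rw [norm_neg]

end SqrtNear

/-! ### Quaternions in coordinates and the topological group of pairs. -/

section Coordinates

variable {p : ℕ} [Fact p.Prime]

/-- The norm form of the quaternion algebra with parameters `a`, `b`. -/
def quatForm (a b : ℚ_[p]) (q : Fin 4 → ℚ_[p]) : ℚ_[p] :=
  q 0 ^ 2 - a * q 1 ^ 2 - b * q 2 ^ 2 + a * b * q 3 ^ 2

variable {a b : ℚ_[p]}

/-- The coordinates of a quaternion in the basis `1, i, j, ε⁻¹ ij`, for a sign `ε`. -/
def quatCoords (ε : ℚ_[p]) (x : QuaternionAlgebra ℚ_[p] a 0 b) : Fin 4 → ℚ_[p] :=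
  ![x.re, x.imI, x.imJ, ε * x.imK]

variable (a b) in
/-- The quaternion with given coordinates in the basis `1, i, j, ε ij`, for a sign `ε`. -/
def ofCoords (ε : ℚ_[p]) (q : Fin 4 → ℚ_[p]) : QuaternionAlgebra ℚ_[p] a 0 b :=
  ⟨q 0, q 1, q 2, ε * q 3⟩

variable {ε : ℚ_[p]}

theorem eq_one_or_eq_neg_one_of_sq (hε : ε ^ 2 = 1) : ε = 1 ∨ ε = -1 :=
  sq_eq_sq_iff_eq_or_eq_neg.1 (by rw [hε, one_pow])

theorem ofCoords_quatCoords (hε : ε ^ 2 = 1) (x : QuaternionAlgebra ℚ_[p] a 0 b) :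
    ofCoords a b ε (quatCoords ε x) = x := by
  ext <;> simp [ofCoords, quatCoords, ← mul_assoc, ← sq, hε]

theorem quatCoords_ofCoords (hε : ε ^ 2 = 1) (q : Fin 4 → ℚ_[p]) :
    quatCoords ε (ofCoords a b ε q) = q := by
  ext i; fin_cases i <;> simp [ofCoords, quatCoords, ← mul_assoc, ← sq, hε]

theorem quatForm_quatCoords (hε : ε ^ 2 = 1) (x : QuaternionAlgebra ℚ_[p] a 0 b) :
    quatForm a b (quatCoords ε x) = nrd p a b x := by
  simp [nrd, quatForm, quatCoords, mul_pow, hε]; ring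

theorem nrd_ofCoords (hε : ε ^ 2 = 1) (q : Fin 4 → ℚ_[p]) :
    nrd p a b (ofCoords a b ε q) = quatForm a b q := by
  rw [← quatForm_quatCoords hε, quatCoords_ofCoords hε]

theorem continuous_quatForm : Continuous (quatForm a b) := by
  unfold quatForm; fun_prop

/-- The matrix of the left multiplication by `x`. -/
def mulMatrix (ε : ℚ_[p]) (x : QuaternionAlgebra ℚ_[p] a 0 b) : Matrix (Fin 4) (Fin 4) ℚ_[p] :=
  !![x.re, a * x.imI, b * x.imJ, -(a * b * ε * x.imK);
    x.imI, x.re, b * x.imK, -(b * ε * x.imJ);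
    x.imJ, -(a * x.imK), x.re, a * ε * x.imI;
    ε * x.imK, -(ε * x.imJ), ε * x.imI, x.re]

theorem mulMatrix_mulVec (hε : ε ^ 2 = 1) (x y : QuaternionAlgebra ℚ_[p] a 0 b) :
    (mulMatrix ε x).mulVec (quatCoords ε y) = quatCoords ε (x * y) := by
  ext i
  fin_cases i <;>
    simp [mulMatrix, quatCoords, Matrix.mulVec, dotProduct, Fin.sum_univ_four] <;>
    rcases eq_one_or_eq_neg_one_of_sq hε with rfl | rfl <;> ring

/-- This is the Jacobian of left translation on ℍ; two factors of equal reduced norm produce the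
fourth power in `pairDensity`. -/
theorem det_mulMatrix (hε : ε ^ 2 = 1) (x : QuaternionAlgebra ℚ_[p] a 0 b) :
    (mulMatrix ε x).det = nrd p a b x ^ 2 := by
  simp [mulMatrix, Matrix.det_succ_row_zero, Fin.sum_univ_succ, nrd, Fin.succAbove]
  rcases eq_one_or_eq_neg_one_of_sq hε with rfl | rfl <;> ring

theorem mul_smul_star (x : QuaternionAlgebra ℚ_[p] a 0 b) (hx : nrd p a b x ≠ 0) :
    x * ((nrd p a b x)⁻¹ • star x) = 1 := by
  have h : x * star x = nrd p a b x • 1 := by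
    ext <;> simp [nrd] <;> ring
  rw [mul_smul_comm, h, smul_smul, inv_mul_cancel₀ hx, one_smul]

theorem smul_star_mul (x : QuaternionAlgebra ℚ_[p] a 0 b) (hx : nrd p a b x ≠ 0) :
    ((nrd p a b x)⁻¹ • star x) * x = 1 := by
  have h : star x * x = nrd p a b x • 1 := by
    ext <;> simp [nrd] <;> ring
  rw [smul_mul_assoc, h, smul_smul, inv_mul_cancel₀ hx, one_smul]

/-- A quaternion of nonzero reduced norm as a unit. -/
def unitOfNrd (x : QuaternionAlgebra ℚ_[p] a 0 b) (hx : nrd p a b x ≠ 0) :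
    (QuaternionAlgebra ℚ_[p] a 0 b)ˣ :=
  ⟨x, (nrd p a b x)⁻¹ • star x, mul_smul_star x hx, smul_star_mul x hx⟩

theorem nrd_unit_ne_zero (u : (QuaternionAlgebra ℚ_[p] a 0 b)ˣ) : nrd p a b u ≠ 0 :=
  (Units.map (nrd p a b) u).ne_zero

theorem coe_inv_unit (u : (QuaternionAlgebra ℚ_[p] a 0 b)ˣ) :
    ((u⁻¹ : (QuaternionAlgebra ℚ_[p] a 0 b)ˣ) : QuaternionAlgebra ℚ_[p] a 0 b) =
      (nrd p a b u)⁻¹ • star (u : QuaternionAlgebra ℚ_[p] a 0 b) :=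
  Units.inv_eq_of_mul_eq_one_right (mul_smul_star _ (nrd_unit_ne_zero u))

/-- The coordinates of a pair of quaternions. -/
def pairCoords (ε : ℚ_[p]) (g : quatPairs p a b) : (Fin 4 → ℚ_[p]) × (Fin 4 → ℚ_[p]) :=
  (quatCoords ε (g.1.1 : QuaternionAlgebra ℚ_[p] a 0 b),
    quatCoords ε (g.1.2 : QuaternionAlgebra ℚ_[p] a 0 b))

/-- The pairs of coordinate vectors of the elements of `quatPairs`. -/
def IsPair (a b : ℚ_[p]) (z : (Fin 4 → ℚ_[p]) × (Fin 4 → ℚ_[p])) : Prop :=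
  quatForm a b z.1 = quatForm a b z.2 ∧ quatForm a b z.2 ≠ 0

theorem isPair_pairCoords (hε : ε ^ 2 = 1) (g : quatPairs p a b) : IsPair a b (pairCoords ε g) := by
  simp only [IsPair, pairCoords, quatForm_quatCoords hε]
  exact ⟨g.2, nrd_unit_ne_zero _⟩

theorem pairCoords_injective (hε : ε ^ 2 = 1) :
    Function.Injective (pairCoords ε : quatPairs p a b → _) := by
  intro g h hgh
  simp only [pairCoords, Prod.mk.injEq] at hgh
  have h1 := congrArg (ofCoords a b ε) hgh.1
  have h2 := congrArg (ofCoords a b ε) hgh.2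
  rw [ofCoords_quatCoords hε, ofCoords_quatCoords hε] at h1 h2
  exact Subtype.ext (Prod.ext (Units.ext h1) (Units.ext h2))

theorem exists_pairCoords_eq (hε : ε ^ 2 = 1) {z : (Fin 4 → ℚ_[p]) × (Fin 4 → ℚ_[p])}
    (hz : IsPair a b z) : ∃ g : quatPairs p a b, pairCoords ε g = z := by
  have h1 : nrd p a b (ofCoords a b ε z.1) ≠ 0 := by
    rw [nrd_ofCoords hε, hz.1]; exact hz.2
  have h2 : nrd p a b (ofCoords a b ε z.2) ≠ 0 := by
    rw [nrd_ofCoords hε]; exact hz.2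
  refine ⟨⟨(unitOfNrd _ h1, unitOfNrd _ h2), ?_⟩, ?_⟩
  · show nrd p a b (ofCoords a b ε z.1) = nrd p a b (ofCoords a b ε z.2)
    rw [nrd_ofCoords hε, nrd_ofCoords hε, hz.1]
  · exact Prod.ext (quatCoords_ofCoords hε _) (quatCoords_ofCoords hε _)

variable (a b ε) in
/-- The element of the group with given coordinates (and `1` if there is none). -/
def mkPair (z : (Fin 4 → ℚ_[p]) × (Fin 4 → ℚ_[p])) : quatPairs p a b :=
  open scoped Classical in if h : ∃ g : quatPairs p a b, pairCoords ε g = z then h.choose else 1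

theorem pairCoords_mkPair (hε : ε ^ 2 = 1) {z : (Fin 4 → ℚ_[p]) × (Fin 4 → ℚ_[p])}
    (hz : IsPair a b z) : pairCoords ε (mkPair a b ε z) = z := by
  rw [mkPair, dif_pos (exists_pairCoords_eq hε hz)]
  exact (exists_pairCoords_eq hε hz).choose_spec

theorem isInducing_pairCoords (hε : ε ^ 2 = 1) :
    IsInducing (pairCoords ε : quatPairs p a b → _) := by
  let s : (Fin 4 → ℚ_[p]) ≃ₜ (Fin 4 → ℚ_[p]) :=
    { toFun := fun q => ![q 0, q 1, q 2, ε * q 3]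
      invFun := fun q => ![q 0, q 1, q 2, ε * q 3]
      left_inv := fun q => by
        ext i; fin_cases i <;> simp [← mul_assoc, ← sq, hε]
      right_inv := fun q => by
        ext i; fin_cases i <;> simp [← mul_assoc, ← sq, hε]
      continuous_toFun := by fun_prop
      continuous_invFun := by fun_prop }
  have h0 : IsInducing fun g : quatPairs p a b =>
      (QuaternionAlgebra.equivTuple a 0 b (g.1.1 : QuaternionAlgebra ℚ_[p] a 0 b),
        QuaternionAlgebra.equivTuple a 0 b (g.1.2 : QuaternionAlgebra ℚ_[p] a 0 b)) := ⟨rfl⟩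
  exact ((s.prodCongr s).isInducing.comp h0)

theorem continuous_pairCoords (hε : ε ^ 2 = 1) :
    Continuous (pairCoords ε : quatPairs p a b → _) := (isInducing_pairCoords hε).continuous

theorem continuousOn_mkPair (hε : ε ^ 2 = 1) :
    ContinuousOn (mkPair a b ε) {z | IsPair a b z} := by
  rw [(isInducing_pairCoords hε).continuousOn_iff]
  exact continuousOn_id.congr fun z hz => pairCoords_mkPair hε hz

/-- Continuity is phrased through coordinates, so that no topology on the quaternion algebra itself
enters. -/
theorem continuous_quatCoords_mul (hε : ε ^ 2 = 1) {X : Type*} [TopologicalSpace X]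
    {f g : X → QuaternionAlgebra ℚ_[p] a 0 b} (hf : Continuous fun x => quatCoords ε (f x))
    (hg : Continuous fun x => quatCoords ε (g x)) :
    Continuous fun x => quatCoords ε (f x * g x) := by
  have h : ∀ x, f x * g x = ofCoords a b ε (quatCoords ε (f x)) *
      ofCoords a b ε (quatCoords ε (g x)) := fun x => by
    rw [ofCoords_quatCoords hε, ofCoords_quatCoords hε]
  simp_rw [h]
  generalize hF : (fun x => quatCoords ε (f x)) = F at hf
  generalize hG : (fun x => quatCoords ε (g x)) = G at hg
  have h' : ∀ x, quatCoords ε (ofCoords a b ε (quatCoords ε (f x)) *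
      ofCoords a b ε (quatCoords ε (g x))) =
      quatCoords ε (ofCoords a b ε (F x) * ofCoords a b ε (G x)) := fun x => by rw [← hF, ← hG]
  simp_rw [h']
  refine continuous_pi fun i => ?_
  simp only [quatCoords, ofCoords]
  fin_cases i <;> simp <;> fun_prop

theorem continuous_quatCoords_inv (hε : ε ^ 2 = 1) {X : Type*} [TopologicalSpace X]
    {f : X → (QuaternionAlgebra ℚ_[p] a 0 b)ˣ}
    (hf : Continuous fun x => quatCoords ε (f x : QuaternionAlgebra ℚ_[p] a 0 b)) :
    Continuous fun x => quatCoords ε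
      (((f x)⁻¹ : (QuaternionAlgebra ℚ_[p] a 0 b)ˣ) : QuaternionAlgebra ℚ_[p] a 0 b) := by
  have h1 : Continuous fun x => (nrd p a b (f x))⁻¹ := by
    simp_rw [← quatForm_quatCoords hε]
    refine (continuous_quatForm.comp hf).inv₀ fun x => ?_
    simp only [Function.comp_apply, quatForm_quatCoords hε]
    exact nrd_unit_ne_zero _
  have h2 : ∀ x, quatCoords ε
      (((f x)⁻¹ : (QuaternionAlgebra ℚ_[p] a 0 b)ˣ) : QuaternionAlgebra ℚ_[p] a 0 b) =
      (nrd p a b (f x))⁻¹ • ![quatCoords ε (f x).1 0, -quatCoords ε (f x).1 1,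
        -quatCoords ε (f x).1 2, -quatCoords ε (f x).1 3] := fun x => by
    rw [coe_inv_unit]
    ext i; fin_cases i <;> simp [quatCoords]
    ring
  simp_rw [h2]
  fun_prop

theorem isTopologicalGroup_quatPairs (hε : ε ^ 2 = 1) : IsTopologicalGroup (quatPairs p a b) where
  continuous_mul := by
    rw [(isInducing_pairCoords hε).continuous_iff]
    have h1 := (continuous_pairCoords (a := a) (b := b) hε).comp continuous_fst
      (X := quatPairs p a b × quatPairs p a b)
    have h2 := (continuous_pairCoords (a := a) (b := b) hε).comp continuous_snd
      (X := quatPairs p a b × quatPairs p a b)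
    exact (continuous_quatCoords_mul hε h1.fst h2.fst).prodMk
      (continuous_quatCoords_mul hε h1.snd h2.snd)
  continuous_inv := by
    rw [(isInducing_pairCoords hε).continuous_iff]
    have h1 := continuous_pairCoords (a := a) (b := b) hε
    exact (continuous_quatCoords_inv hε h1.fst).prodMk (continuous_quatCoords_inv hε h1.snd)

instance : IsTopologicalGroup (quatPairs p a b) :=
  isTopologicalGroup_quatPairs (ε := 1) (one_pow 2)

instance : SecondCountableTopology (quatPairs p a b) :=
  (isInducing_pairCoords (one_pow 2)).secondCountableTopology

end Coordinates

/-! ### The chart of seven coordinates and the local branches of its inverse. -/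

section Chart

variable {p : ℕ} [Fact p.Prime]

/-- The last seven coordinates of a pair of coordinate vectors. -/
def coordChart (z : (Fin 4 → ℚ_[p]) × (Fin 4 → ℚ_[p])) : Fin 7 → ℚ_[p] :=
  ![z.1 1, z.1 2, z.1 3, z.2 0, z.2 1, z.2 2, z.2 3]

/-- The splitting of `ℚ_p ^ 8` into the first coordinate and the seven others. -/
def coordSplit : ((Fin 4 → ℚ_[p]) × (Fin 4 → ℚ_[p])) ≃L[ℚ_[p]] ℚ_[p] × (Fin 7 → ℚ_[p]) where
  toFun z := (z.1 0, coordChart z)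
  invFun w := (![w.1, w.2 0, w.2 1, w.2 2], ![w.2 3, w.2 4, w.2 5, w.2 6])
  map_add' z w := by
    ext i
    · rfl
    · fin_cases i <;> rfl
  map_smul' c z := by
    ext i
    · rfl
    · fin_cases i <;> rfl
  left_inv z := by ext i <;> fin_cases i <;> rfl
  right_inv w := by
    ext i
    · rfl
    · fin_cases i <;> rfl
  continuous_toFun := by
    refine (by fun_prop : Continuous fun z : (Fin 4 → ℚ_[p]) × (Fin 4 → ℚ_[p]) =>
      z.1 0).prodMk (continuous_pi fun i => ?_)
    fin_cases i <;> simp [coordChart] <;> fun_prop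
  continuous_invFun := by
    refine Continuous.prodMk (continuous_pi fun i => ?_) (continuous_pi fun i => ?_) <;>
    fin_cases i <;> simp <;> fun_prop

theorem coordSplit_apply (z : (Fin 4 → ℚ_[p]) × (Fin 4 → ℚ_[p])) :
    coordSplit z = (z.1 0, coordChart z) := rfl

theorem coordChart_coordSplit_symm (t : ℚ_[p]) (y : Fin 7 → ℚ_[p]) :
    coordChart (coordSplit.symm (t, y)) = y :=
  congrArg Prod.snd (coordSplit.apply_symm_apply (t, y))

theorem continuous_coordChart : Continuous (coordChart : _ → Fin 7 → ℚ_[p]) :=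
  continuous_snd.comp coordSplit.continuous

theorem norm_coordSplit (z : (Fin 4 → ℚ_[p]) × (Fin 4 → ℚ_[p])) : ‖coordSplit z‖ = ‖z‖ := by
  apply le_antisymm
  · rw [coordSplit_apply, Prod.norm_def]
    refine max_le ((norm_le_pi_norm z.1 0).trans (norm_fst_le z)) ?_
    rw [pi_norm_le_iff_of_nonneg (norm_nonneg _)]
    intro i
    fin_cases i <;> simp only [coordChart]
    exacts [(norm_le_pi_norm z.1 1).trans (norm_fst_le z),
      (norm_le_pi_norm z.1 2).trans (norm_fst_le z),
      (norm_le_pi_norm z.1 3).trans (norm_fst_le z),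
      (norm_le_pi_norm z.2 0).trans (norm_snd_le z),
      (norm_le_pi_norm z.2 1).trans (norm_snd_le z),
      (norm_le_pi_norm z.2 2).trans (norm_snd_le z),
      (norm_le_pi_norm z.2 3).trans (norm_snd_le z)]
  · have h0 := norm_fst_le (coordSplit z)
    have h1 := fun i => (norm_le_pi_norm (coordSplit z).2 i).trans (norm_snd_le (coordSplit z))
    rw [Prod.norm_def (x := z)]
    refine max_le ?_ ?_ <;> rw [pi_norm_le_iff_of_nonneg (norm_nonneg _)] <;> intro i <;>
      fin_cases i
    exacts [h0, h1 0, h1 1, h1 2, h1 3, h1 4, h1 5, h1 6]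

variable (a b : ℚ_[p])

/-- The norm form of the last four coordinates. -/
def tailForm (y : Fin 7 → ℚ_[p]) : ℚ_[p] := quatForm a b ![y 3, y 4, y 5, y 6]

/-- The square of the missing coordinate, as a function of the seven others. -/
def radicand (y : Fin 7 → ℚ_[p]) : ℚ_[p] :=
  tailForm a b y + a * y 0 ^ 2 + b * y 1 ^ 2 - a * b * y 2 ^ 2

theorem continuous_tailForm : Continuous (tailForm a b) := by
  refine continuous_quatForm.comp (continuous_pi fun i => ?_)
  fin_cases i <;> simp <;> fun_prop

theorem continuous_radicand : Continuous (radicand a b) := by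
  have := continuous_tailForm a b
  unfold radicand; fun_prop

variable {a b}

theorem quatForm_snd (z : (Fin 4 → ℚ_[p]) × (Fin 4 → ℚ_[p])) :
    quatForm a b z.2 = tailForm a b (coordChart z) := by
  simp [tailForm, quatForm, coordChart]

theorem quatForm_fst (z : (Fin 4 → ℚ_[p]) × (Fin 4 → ℚ_[p])) :
    quatForm a b z.1 = z.1 0 ^ 2 - radicand a b (coordChart z) + tailForm a b (coordChart z) := by
  simp [radicand, quatForm, coordChart]; ring

variable {ε : ℚ_[p]}

/-- The chart of the group given by the last seven coordinates. -/
def pairChart (ε : ℚ_[p]) (g : quatPairs p a b) : Fin 7 → ℚ_[p] := coordChart (pairCoords ε g)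

theorem continuous_pairChart (hε : ε ^ 2 = 1) :
    Continuous (pairChart ε : quatPairs p a b → _) :=
  continuous_coordChart.comp (continuous_pairCoords hε)

theorem continuous_re (hε : ε ^ 2 = 1) :
    Continuous fun g : quatPairs p a b => (pairCoords ε g).1 0 :=
  (continuous_apply 0).comp (continuous_fst.comp (continuous_pairCoords hε))

/-- The equation nrd γ = nrd δ, solved for c₀². -/
theorem re_sq_eq_radicand (hε : ε ^ 2 = 1) (g : quatPairs p a b) :
    (pairCoords ε g).1 0 ^ 2 = radicand a b (pairChart ε g) := by
  have h := (isPair_pairCoords hε g).1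
  rw [quatForm_fst, quatForm_snd] at h
  rw [pairChart]
  linear_combination h

theorem tailForm_pairChart_ne_zero (hε : ε ^ 2 = 1) (g : quatPairs p a b) :
    tailForm a b (pairChart ε g) ≠ 0 := by
  rw [pairChart, ← quatForm_snd]
  exact (isPair_pairCoords hε g).2

theorem eq_of_re_eq_of_pairChart_eq (hε : ε ^ 2 = 1) {g h : quatPairs p a b}
    (h0 : (pairCoords ε g).1 0 = (pairCoords ε h).1 0) (h1 : pairChart ε g = pairChart ε h) :
    g = h :=
  pairCoords_injective hε (coordSplit.injective (Prod.ext h0 h1))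

variable (a b) in
/-- The domain of the branch of the inverse chart with first coordinate close to `c`. -/
def sectionDomain (c : ℚ_[p]) : Set (Fin 7 → ℚ_[p]) :=
  {y | ‖radicand a b y / c ^ 2 - 1‖ < ‖(4 : ℚ_[p])‖ ∧ tailForm a b y ≠ 0}

variable (a b) in
/-- The first coordinate, close to `c`, as a function of the seven others. -/
def sectionRe (c : ℚ_[p]) (y : Fin 7 → ℚ_[p]) : ℚ_[p] := c * sqrtNear (radicand a b y / c ^ 2)

variable (a b ε) in
/-- The branch of the inverse chart with first coordinate close to `c`. -/
def chartSection (c : ℚ_[p]) (y : Fin 7 → ℚ_[p]) : quatPairs p a b :=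
  mkPair a b ε (coordSplit.symm (sectionRe a b c y, y))

theorem isOpen_sectionDomain (c : ℚ_[p]) : IsOpen (sectionDomain a b c) := by
  have h1 := continuous_radicand a b
  have h2 := continuous_tailForm a b
  refine IsOpen.inter (isOpen_lt (f := fun y => ‖radicand a b y / c ^ 2 - 1‖) (by fun_prop)
    continuous_const) ?_
  exact isOpen_ne_fun h2 continuous_const

theorem continuous_sectionRe (c : ℚ_[p]) : Continuous (sectionRe a b c) := by
  have h1 := continuous_radicand a b
  have h2 := continuous_sqrtNear (p := p)
  unfold sectionRe
  fun_prop

variable {c : ℚ_[p]}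

theorem sectionRe_sq (hc : c ≠ 0) {y : Fin 7 → ℚ_[p]} (hy : y ∈ sectionDomain a b c) :
    sectionRe a b c y ^ 2 = radicand a b y := by
  rw [sectionRe, mul_pow, sqrtNear_sq hy.1]
  field_simp

theorem norm_sectionRe_sub_lt (hc : c ≠ 0) (y : Fin 7 → ℚ_[p]) :
    ‖sectionRe a b c y - c‖ < ‖2 * c‖ := by
  have := norm_sqrtNear_sub_one_lt (radicand a b y / c ^ 2)
  rw [sectionRe, show c * sqrtNear (radicand a b y / c ^ 2) - c =
    (sqrtNear (radicand a b y / c ^ 2) - 1) * c by ring, norm_mul, norm_mul]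
  exact mul_lt_mul_of_pos_right this (norm_pos_iff.2 hc)

theorem isPair_section (hc : c ≠ 0) {y : Fin 7 → ℚ_[p]} (hy : y ∈ sectionDomain a b c) :
    IsPair a b (coordSplit.symm (sectionRe a b c y, y)) := by
  rw [IsPair, quatForm_fst, quatForm_snd, coordChart_coordSplit_symm]
  refine ⟨?_, hy.2⟩
  show sectionRe a b c y ^ 2 - _ + _ = _
  rw [sectionRe_sq hc hy, sub_self, zero_add]

theorem pairCoords_chartSection (hε : ε ^ 2 = 1) (hc : c ≠ 0) {y : Fin 7 → ℚ_[p]}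
    (hy : y ∈ sectionDomain a b c) :
    pairCoords ε (chartSection a b ε c y) = coordSplit.symm (sectionRe a b c y, y) :=
  pairCoords_mkPair hε (isPair_section hc hy)

theorem pairChart_chartSection (hε : ε ^ 2 = 1) (hc : c ≠ 0) {y : Fin 7 → ℚ_[p]}
    (hy : y ∈ sectionDomain a b c) : pairChart ε (chartSection a b ε c y) = y := by
  rw [pairChart, pairCoords_chartSection hε hc hy, coordChart_coordSplit_symm]

theorem re_chartSection (hε : ε ^ 2 = 1) (hc : c ≠ 0) {y : Fin 7 → ℚ_[p]}
    (hy : y ∈ sectionDomain a b c) :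
    (pairCoords ε (chartSection a b ε c y)).1 0 = sectionRe a b c y := by
  rw [pairCoords_chartSection hε hc hy]; rfl

theorem continuousOn_chartSection (hε : ε ^ 2 = 1) (hc : c ≠ 0) :
    ContinuousOn (chartSection a b ε c) (sectionDomain a b c) := by
  refine (continuousOn_mkPair hε).comp (Continuous.continuousOn ?_)
    fun y hy => isPair_section hc hy
  exact coordSplit.symm.continuous.comp ((continuous_sectionRe c).prodMk continuous_id)

variable (a b ε) in
/-- The elements of the group with first coordinate close to `c`. -/
def nearRe (c : ℚ_[p]) : Set (quatPairs p a b) := {g | ‖(pairCoords ε g).1 0 - c‖ < ‖2 * c‖}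

theorem isOpen_nearRe (hε : ε ^ 2 = 1) (c : ℚ_[p]) : IsOpen (nearRe a b ε c) := by
  have := continuous_re (a := a) (b := b) hε
  exact isOpen_lt (by fun_prop) continuous_const

/-- With c₀ near `c` one has |c₀² - c²| = |2c| |c₀ - c| < |2c|² = |4c²|, which is the Hensel
condition for c₀² / c². -/
theorem pairChart_mem_sectionDomain (hε : ε ^ 2 = 1) (hc : c ≠ 0) {g : quatPairs p a b}
    (hg : g ∈ nearRe a b ε c) : pairChart ε g ∈ sectionDomain a b c := by
  refine ⟨?_, tailForm_pairChart_ne_zero hε g⟩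
  have h2 : 0 < ‖2 * c‖ := norm_pos_iff.2 (mul_ne_zero two_ne_zero hc)
  have h : ‖(pairCoords ε g).1 0 ^ 2 - c ^ 2‖ = ‖2 * c‖ * ‖(pairCoords ε g).1 0 - c‖ :=
    norm_sq_sub_of_near hg (by simpa using hc)
  rw [← re_sq_eq_radicand hε, show (pairCoords ε g).1 0 ^ 2 / c ^ 2 - 1 =
    ((pairCoords ε g).1 0 ^ 2 - c ^ 2) / c ^ 2 by field_simp, norm_div, h,
    div_lt_iff₀ (by rw [norm_pos_iff]; exact pow_ne_zero 2 hc), ← norm_mul 4,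
    show 4 * c ^ 2 = (2 * c) * (2 * c) by ring, norm_mul (2 * c)]
  exact mul_lt_mul_of_pos_left hg h2

/-- The two first coordinates are square roots of the same radicand and both are near `c`, so they
coincide. -/
theorem chartSection_pairChart (hε : ε ^ 2 = 1) (hc : c ≠ 0) {g : quatPairs p a b}
    (hg : g ∈ nearRe a b ε c) : chartSection a b ε c (pairChart ε g) = g := by
  have hy := pairChart_mem_sectionDomain hε hc hg
  refine eq_of_re_eq_of_pairChart_eq hε ?_ (pairChart_chartSection hε hc hy)
  rw [re_chartSection hε hc hy]
  refine eq_of_sq_eq_of_near (norm_sectionRe_sub_lt hc _) hg ?_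
  rw [sectionRe_sq hc hy, re_sq_eq_radicand hε]

theorem chartSection_mem_nearRe (hε : ε ^ 2 = 1) (hc : c ≠ 0) {y : Fin 7 → ℚ_[p]}
    (hy : y ∈ sectionDomain a b c) : chartSection a b ε c y ∈ nearRe a b ε c := by
  rw [nearRe, Set.mem_ofPred_eq, re_chartSection hε hc hy]
  exact norm_sectionRe_sub_lt hc y

theorem mem_nearRe_self (hc : c ≠ 0) {g : quatPairs p a b} (hg : (pairCoords ε g).1 0 = c) :
    g ∈ nearRe a b ε c := by
  rw [nearRe, Set.mem_ofPred_eq, hg, sub_self, norm_zero, norm_pos_iff]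
  exact mul_ne_zero two_ne_zero hc

/-- Near a point where the first coordinate does not vanish, the inverse chart takes a small
neighbourhood of the image into any given neighbourhood. -/
theorem eventually_chartSection_mem (hε : ε ^ 2 = 1) {U : Set (quatPairs p a b)} (hU : IsOpen U)
    {g : quatPairs p a b} (hg : g ∈ U) (hc : c ≠ 0) (hgc : (pairCoords ε g).1 0 = c) :
    ∀ᶠ y in 𝓝 (pairChart ε g), y ∈ sectionDomain a b c ∧ chartSection a b ε c y ∈ U := by
  have hn := mem_nearRe_self hc hgc
  have hd := (isOpen_sectionDomain c).mem_nhds (pairChart_mem_sectionDomain hε hc hn)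
  have hcont := (continuousOn_chartSection hε hc).continuousAt hd
  refine Filter.Eventually.and hd (hcont.eventually_mem (hU.mem_nhds ?_))
  rwa [chartSection_pairChart hε hc hn]

theorem isOpen_image_pairChart (hε : ε ^ 2 = 1) {U : Set (quatPairs p a b)} (hU : IsOpen U)
    (h0 : ∀ g ∈ U, (pairCoords ε g).1 0 ≠ 0) : IsOpen (pairChart ε '' U) := by
  rw [isOpen_iff_mem_nhds]
  rintro _ ⟨g, hg, rfl⟩
  filter_upwards [eventually_chartSection_mem hε hU hg (h0 g hg) rfl] with y hy
  exact ⟨_, hy.2, pairChart_chartSection hε (h0 g hg) hy.1⟩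

theorem isOpenEmbedding_domRestrict_pairChart (hε : ε ^ 2 = 1) {U : Set (quatPairs p a b)}
    (hU : IsOpen U) (h0 : ∀ g ∈ U, (pairCoords ε g).1 0 ≠ 0) (hi : Set.InjOn (pairChart ε) U) :
    IsOpenEmbedding (U.domRestrict (pairChart ε)) := by
  refine .of_continuous_injective_isOpenMap
    ((continuous_pairChart hε).comp continuous_subtype_val) (Set.injOn_iff_injective.1 hi) ?_
  intro V hV
  have : U.domRestrict (pairChart ε) '' V = pairChart ε '' (Subtype.val '' V) := by
    rw [Set.image_image]; rfl
  rw [this]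
  refine isOpen_image_pairChart hε (hU.isOpenMap_subtype_val _ hV) ?_
  rintro _ ⟨g, -, rfl⟩
  exact h0 g g.2

/-- The chart is not injective near a point where the first coordinate vanishes. -/
theorem re_ne_zero_of_injOn (hε : ε ^ 2 = 1) {U : Set (quatPairs p a b)} (hU : IsOpen U)
    (hi : Set.InjOn (pairChart ε) U) {g : quatPairs p a b} (hg : g ∈ U) :
    (pairCoords ε g).1 0 ≠ 0 := by
  intro h0
  set z := pairCoords ε g with hz
  have hzp : IsPair a b z := isPair_pairCoords hε g
  set n := quatForm a b z.2 with hn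
  have hn0 : n ≠ 0 := hzp.2
  have hn1 : quatForm a b z.1 = n := hzp.1
  -- Let γ be the quaternion `z.1`. It is pure of reduced norm `n`, so γ² = -n, and `x s` is γ (1 +
  -- sγ)(1 - sγ)⁻¹, again of norm `n`. Its first coordinate is odd in `s` and the other three are
  -- even, so `x s` and `x (-s)` have the same image in the chart but differ for small `s ≠ 0`.
  let x : ℚ_[p] → Fin 4 → ℚ_[p] := fun s =>
    ![(1 + s ^ 2 * n)⁻¹ * -(2 * s * n), (1 + s ^ 2 * n)⁻¹ * ((1 - s ^ 2 * n) * z.1 1),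
      (1 + s ^ 2 * n)⁻¹ * ((1 - s ^ 2 * n) * z.1 2), (1 + s ^ 2 * n)⁻¹ * ((1 - s ^ 2 * n) * z.1 3)]
  have hx0 : ∀ s, x s 0 = (1 + s ^ 2 * n)⁻¹ * -(2 * s * n) := fun s => rfl
  have hpair : ∀ s, 1 + s ^ 2 * n ≠ 0 → IsPair a b (x s, z.2) := by
    intro s hs
    refine ⟨?_, hn0⟩
    show quatForm a b (x s) = n
    have e : quatForm a b z.1 = 0 - a * z.1 1 ^ 2 - b * z.1 2 ^ 2 + a * b * z.1 3 ^ 2 := by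
      simp [quatForm, h0]
    rw [hn1] at e
    simp only [quatForm, x, Matrix.cons_val]
    field_simp
    linear_combination -(1 - s ^ 2 * n) ^ 2 * e
  have hcont : ContinuousAt (fun s => (x s, z.2)) 0 := by
    refine ContinuousAt.prodMk ?_ continuousAt_const
    have hi : ContinuousAt (fun s : ℚ_[p] => (1 + s ^ 2 * n)⁻¹) 0 :=
      ContinuousAt.inv₀ (by fun_prop) (by simp)
    refine continuousAt_pi.2 fun i => ?_
    fin_cases i <;> simp only [x, Fin.reduceFinMk, Fin.isValue, Fin.zero_eta, Fin.mk_one,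
      Matrix.cons_val] <;> fun_prop
  have hev : ∀ᶠ s : ℚ_[p] in 𝓝 0, 1 + s ^ 2 * n ≠ 0 := by
    have : ContinuousAt (fun s : ℚ_[p] => 1 + s ^ 2 * n) 0 := by fun_prop
    exact this.eventually_ne (by simp)
  obtain ⟨O, hO, hOU⟩ := (isInducing_pairCoords (a := a) (b := b) hε).isOpen_iff.1 hU
  have hO0 : (x 0, z.2) ∈ O := by
    have : (x 0, z.2) = z := by
      refine Prod.ext ?_ rfl
      ext i; fin_cases i <;> simp [x, h0]
    rw [this, hz]
    rw [← hOU] at hg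
    exact hg
  have hevO : ∀ᶠ s : ℚ_[p] in 𝓝 0, (x s, z.2) ∈ O := hcont.eventually_mem (hO.mem_nhds hO0)
  have hneg : Filter.Tendsto (fun s : ℚ_[p] => -s) (𝓝 0) (𝓝 0) := by
    simpa using (continuous_neg (G := ℚ_[p])).tendsto 0
  have hall := (hev.and (hevO.and (hneg.eventually hevO))).filter_mono
    (nhdsWithin_le_nhds (s := {0}ᶜ))
  obtain ⟨s, ⟨hs1, hs2, hs3⟩, hs0⟩ := (hall.and self_mem_nhdsWithin).exists
  have hs1' : 1 + (-s) ^ 2 * n ≠ 0 := by rwa [neg_sq]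
  have m1 := pairCoords_mkPair hε (hpair s hs1)
  have m2 := pairCoords_mkPair hε (hpair (-s) hs1')
  have hU1 : mkPair a b ε (x s, z.2) ∈ U := by
    rw [← hOU, Set.mem_preimage, m1]; exact hs2
  have hU2 : mkPair a b ε (x (-s), z.2) ∈ U := by
    rw [← hOU, Set.mem_preimage, m2]; exact hs3
  have heq := hi hU1 hU2 (by
    rw [pairChart, pairChart, m1, m2]
    ext i
    fin_cases i <;> simp [coordChart, x])
  have h4 : x s 0 = x (-s) 0 := by
    have := congrArg (fun g => (pairCoords ε g).1 0) heq
    simpa only [m1, m2] using this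
  rw [hx0, hx0, neg_sq] at h4
  have h5 := mul_left_cancel₀ (inv_ne_zero hs1) h4
  have h6 : 4 * s * n = 0 := by linear_combination -h5
  rcases mul_eq_zero.1 h6 with h | h
  · rcases mul_eq_zero.1 h with h | h
    · norm_num at h
    · exact hs0 h
  · exact hn0 h

end Chart

/-! ### Tubes around the group and the invariant measure they induce. -/

section Tube

variable {p : ℕ} [Fact p.Prime]

variable (p) in
/-- The Haar measure on the pairs of coordinate vectors. -/
def pairHaar : Measure ((Fin 4 → ℚ_[p]) × (Fin 4 → ℚ_[p])) :=
  (padicHaarPi p 4).prod (padicHaarPi p 4)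

instance : (pairHaar p).IsAddHaarMeasure := by unfold pairHaar; infer_instance

theorem padicHaarPi_closedBall_one (n : ℕ) :
    padicHaarPi p n (Metric.closedBall 0 1) = 1 := by
  rw [padicHaarPi, closedBall_pi _ zero_le_one, Measure.pi_pi]
  simp [padicHaar_closedBall_one]

/-- Both sides are Haar measures, and `coordSplit` preserves the maximum norm, so both give the unit
ball the measure 1. -/
theorem map_coordSplit_pairHaar :
    Measure.map coordSplit (pairHaar p) = (padicHaar p).prod (padicHaarPi p 7) := by
  have hK : (Measure.map coordSplit (pairHaar p)).IsAddHaarMeasure :=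
    ContinuousLinearEquiv.isAddHaarMeasure_map coordSplit (pairHaar p)
  let K : TopologicalSpace.PositiveCompacts (ℚ_[p] × (Fin 7 → ℚ_[p])) :=
    { carrier := Metric.closedBall 0 1
      isCompact' := isCompact_closedBall 0 1
      interior_nonempty' :=
        ⟨0, Metric.ball_subset_interior_closedBall (Metric.mem_ball_self one_pos)⟩ }
  have h1 := Measure.addHaarMeasure_unique (Measure.map coordSplit (pairHaar p)) K
  have h2 := Measure.addHaarMeasure_unique ((padicHaar p).prod (padicHaarPi p 7)) K
  rw [h1, h2]
  congr 1
  show Measure.map coordSplit (pairHaar p) (Metric.closedBall 0 1) =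
    ((padicHaar p).prod (padicHaarPi p 7)) (Metric.closedBall 0 1)
  rw [Measure.map_apply coordSplit.continuous.measurable Metric.isClosed_closedBall.measurableSet]
  have e : coordSplit ⁻¹' Metric.closedBall (0 : ℚ_[p] × (Fin 7 → ℚ_[p])) 1 =
      Metric.closedBall 0 1 := by
    ext z; simp [norm_coordSplit]
  rw [e, ← Prod.mk_zero_zero, ← Prod.mk_zero_zero, ← closedBall_prod_same, ← closedBall_prod_same,
    pairHaar, Measure.prod_prod, Measure.prod_prod]
  simp [padicHaarPi_closedBall_one, padicHaar_closedBall_one]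

variable (a b : ℚ_[p])

/-- The neighbourhood of the pairs of equal norm on which the norms differ relatively
by at most `‖e‖`. -/
def tube (e : ℚ_[p]) : Set ((Fin 4 → ℚ_[p]) × (Fin 4 → ℚ_[p])) :=
  {z | quatForm a b z.2 ≠ 0 ∧ ‖quatForm a b z.1 / quatForm a b z.2 - 1‖ ≤ ‖e‖}

/-- The density of the Haar measure of the multiplicative group of pairs of quaternions. -/
def pairDensity (z : (Fin 4 → ℚ_[p]) × (Fin 4 → ℚ_[p])) : ℝ≥0∞ := ‖quatForm a b z.2 ^ 4‖ₑ⁻¹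

/-- The retraction to the group, rescaling the first quaternion. -/
def tubeProj (ε : ℚ_[p]) (z : (Fin 4 → ℚ_[p]) × (Fin 4 → ℚ_[p])) : quatPairs p a b :=
  mkPair a b ε ((sqrtNear (quatForm a b z.1 / quatForm a b z.2))⁻¹ • z.1, z.2)

/-- The measure on the group of the tubes above sets. -/
def tubeMeasure (ε e : ℚ_[p]) : Measure (quatPairs p a b) :=
  Measure.map (tubeProj a b ε) (((pairHaar p).withDensity (pairDensity a b)).restrict (tube a b e))

variable {a b} {ε : ℚ_[p]}

/-- Coordinates are restored on the measurable set of admissible pairs, and the value is the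
constant 1 elsewhere. -/
theorem measurable_mkPair (hε : ε ^ 2 = 1) : Measurable (mkPair a b ε) := by
  classical
  have hm : Measurable (quatForm a b) := continuous_quatForm.measurable
  have hs : MeasurableSet {z | IsPair a b z} :=
    (measurableSet_eq_fun (hm.comp measurable_fst) (hm.comp measurable_snd)).inter
      ((measurableSet_eq_fun (hm.comp measurable_snd) measurable_const).compl)
  have he : pairCoords ε ∘ mkPair a b ε =
      Set.piecewise {z | IsPair a b z} id fun _ => pairCoords ε (1 : quatPairs p a b) := by
    ext1 z
    by_cases hz : IsPair a b z
    · rw [Set.piecewise_eq_of_mem {z | IsPair a b z} _ _ hz]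
      exact pairCoords_mkPair hε hz
    · rw [Set.piecewise_eq_of_notMem {z | IsPair a b z} _ _ hz, Function.comp_apply, mkPair, dif_neg]
      rintro ⟨g, rfl⟩
      exact hz (isPair_pairCoords hε g)
  have hm2 : Measurable (pairCoords ε ∘ mkPair a b ε) := by
    rw [he]; exact Measurable.piecewise hs measurable_id measurable_const
  refine measurable_of_isOpen fun U hU => ?_
  obtain ⟨O, hO, rfl⟩ := (isInducing_pairCoords (a := a) (b := b) hε).isOpen_iff.1 hU
  exact hm2 hO.measurableSet

theorem measurable_norm_ratio : Measurable fun z : (Fin 4 → ℚ_[p]) × (Fin 4 → ℚ_[p]) =>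
    quatForm a b z.1 / quatForm a b z.2 := by
  have hm : Measurable (quatForm a b) := continuous_quatForm.measurable
  have h1 : Measurable fun z : (Fin 4 → ℚ_[p]) × (Fin 4 → ℚ_[p]) => quatForm a b z.1 :=
    hm.comp measurable_fst
  have h2 : Measurable fun z : (Fin 4 → ℚ_[p]) × (Fin 4 → ℚ_[p]) => quatForm a b z.2 :=
    hm.comp measurable_snd
  exact h1.div h2

theorem measurableSet_tube (e : ℚ_[p]) : MeasurableSet (tube a b e) := by
  have hm : Measurable (quatForm a b) := continuous_quatForm.measurable
  exact ((measurableSet_eq_fun (hm.comp measurable_snd) measurable_const).compl).inter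
    (measurableSet_le (measurable_norm_ratio.sub_const 1).norm measurable_const)

theorem measurable_tubeProj (hε : ε ^ 2 = 1) : Measurable (tubeProj a b ε) := by
  have h := (continuous_sqrtNear (p := p)).measurable.comp (measurable_norm_ratio (a := a) (b := b))
  refine (measurable_mkPair hε).comp (Measurable.prodMk ?_ measurable_snd)
  exact h.inv.smul measurable_fst

theorem measurable_pairDensity : Measurable (pairDensity a b) := by
  have hm : Continuous (fun z : (Fin 4 → ℚ_[p]) × (Fin 4 → ℚ_[p]) => quatForm a b z.2 ^ 4) :=
    (continuous_quatForm.comp continuous_snd).pow 4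
  exact hm.measurable.enorm.inv

variable {e : ℚ_[p]}

theorem tubeMeasure_apply (hε : ε ^ 2 = 1) {A : Set (quatPairs p a b)} (hA : MeasurableSet A) :
    tubeMeasure a b ε e A =
      ∫⁻ z in tube a b e ∩ tubeProj a b ε ⁻¹' A, pairDensity a b z ∂pairHaar p := by
  have hm := measurable_tubeProj (a := a) (b := b) hε hA
  rw [tubeMeasure, Measure.map_apply (measurable_tubeProj hε) hA, Measure.restrict_apply hm,
    withDensity_apply _ (hm.inter (measurableSet_tube e)), Set.inter_comm]

theorem tubeMeasure_apply_indicator (hε : ε ^ 2 = 1) {A : Set (quatPairs p a b)}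
    (hA : MeasurableSet A) :
    tubeMeasure a b ε e A =
      ∫⁻ z, (tube a b e ∩ tubeProj a b ε ⁻¹' A).indicator (pairDensity a b) z ∂pairHaar p := by
  rw [tubeMeasure_apply hε hA,
    lintegral_indicator ((measurableSet_tube e).inter (measurable_tubeProj hε hA))]

/-- The norm form is homogeneous of degree 2, so dividing by a square root of the ratio makes the
two norms equal. -/
theorem pairCoords_tubeProj (hε : ε ^ 2 = 1) (he : ‖e‖ < ‖(4 : ℚ_[p])‖)
    {z : (Fin 4 → ℚ_[p]) × (Fin 4 → ℚ_[p])} (hz : z ∈ tube a b e) :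
    pairCoords ε (tubeProj a b ε z) =
      ((sqrtNear (quatForm a b z.1 / quatForm a b z.2))⁻¹ • z.1, z.2) := by
  refine pairCoords_mkPair hε ⟨?_, hz.1⟩
  have h := sqrtNear_sq (hz.2.trans_lt he)
  have h0 := sqrtNear_ne_zero (quatForm a b z.1 / quatForm a b z.2)
  set s := sqrtNear (quatForm a b z.1 / quatForm a b z.2)
  rw [eq_div_iff hz.1] at h
  have e1 : quatForm a b (s⁻¹ • z.1) = s⁻¹ ^ 2 * quatForm a b z.1 := by
    simp [quatForm]; ring
  show quatForm a b (s⁻¹ • z.1) = quatForm a b z.2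
  rw [e1, ← h]
  field_simp

/-- The action of the group on the pairs of coordinate vectors by left multiplication. -/
def pairAct (ε : ℚ_[p]) (g : quatPairs p a b) :
    (Fin 4 → ℚ_[p]) × (Fin 4 → ℚ_[p]) → (Fin 4 → ℚ_[p]) × (Fin 4 → ℚ_[p]) :=
  Prod.map (Matrix.toLin' (mulMatrix ε (g.1.1 : QuaternionAlgebra ℚ_[p] a 0 b)))
    (Matrix.toLin' (mulMatrix ε (g.1.2 : QuaternionAlgebra ℚ_[p] a 0 b)))

theorem measurable_pairAct (g : quatPairs p a b) : Measurable (pairAct ε g) :=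
  (LinearMap.continuous_on_pi _).measurable.prodMap (LinearMap.continuous_on_pi _).measurable

theorem map_mulMatrix_padicHaarPi (hε : ε ^ 2 = 1) (u : (QuaternionAlgebra ℚ_[p] a 0 b)ˣ) :
    Measure.map (Matrix.toLin' (mulMatrix ε (u : QuaternionAlgebra ℚ_[p] a 0 b)))
      (padicHaarPi p 4) = ‖nrd p a b u ^ 2‖ₑ⁻¹ • padicHaarPi p 4 := by
  rw [← det_mulMatrix hε]
  apply map_matrix_pi_padicHaar
  rw [det_mulMatrix hε]
  exact pow_ne_zero 2 (nrd_unit_ne_zero u)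

theorem map_pairAct_pairHaar (hε : ε ^ 2 = 1) (g : quatPairs p a b) :
    Measure.map (pairAct ε g) (pairHaar p) =
      ‖nrd p a b (g.1.2 : QuaternionAlgebra ℚ_[p] a 0 b) ^ 4‖ₑ⁻¹ • pairHaar p := by
  have hg : nrd p a b (g.1.1 : QuaternionAlgebra ℚ_[p] a 0 b) =
    nrd p a b (g.1.2 : QuaternionAlgebra ℚ_[p] a 0 b) := g.2
  rw [pairAct, pairHaar, ← Measure.map_prod_map _ _ (LinearMap.continuous_on_pi _).measurable
    (LinearMap.continuous_on_pi _).measurable, map_mulMatrix_padicHaarPi hε,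
    map_mulMatrix_padicHaarPi hε, hg, Measure.prod_smul_left, Measure.prod_smul_right, smul_smul,
    ← ENNReal.mul_inv (Or.inr enorm_ne_top) (Or.inl enorm_ne_top), ← enorm_mul, ← pow_add]

theorem toLin_mulMatrix (hε : ε ^ 2 = 1) (x : QuaternionAlgebra ℚ_[p] a 0 b)
    (q : Fin 4 → ℚ_[p]) :
    Matrix.toLin' (mulMatrix ε x) q = quatCoords ε (x * ofCoords a b ε q) := by
  rw [← mulMatrix_mulVec hε, quatCoords_ofCoords hε, Matrix.toLin'_apply]

theorem quatForm_mulMatrix (hε : ε ^ 2 = 1) (x : QuaternionAlgebra ℚ_[p] a 0 b)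
    (q : Fin 4 → ℚ_[p]) :
    quatForm a b (Matrix.toLin' (mulMatrix ε x) q) = nrd p a b x * quatForm a b q := by
  rw [toLin_mulMatrix hε, quatForm_quatCoords hε, map_mul, nrd_ofCoords hε]

theorem quatForm_pairAct_fst (hε : ε ^ 2 = 1) (g : quatPairs p a b)
    (z : (Fin 4 → ℚ_[p]) × (Fin 4 → ℚ_[p])) :
    quatForm a b (pairAct ε g z).1 =
      nrd p a b (g.1.2 : QuaternionAlgebra ℚ_[p] a 0 b) * quatForm a b z.1 := by
  have hg : nrd p a b (g.1.1 : QuaternionAlgebra ℚ_[p] a 0 b) =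
    nrd p a b (g.1.2 : QuaternionAlgebra ℚ_[p] a 0 b) := g.2
  rw [← hg]
  exact quatForm_mulMatrix hε _ _

theorem quatForm_pairAct_snd (hε : ε ^ 2 = 1) (g : quatPairs p a b)
    (z : (Fin 4 → ℚ_[p]) × (Fin 4 → ℚ_[p])) :
    quatForm a b (pairAct ε g z).2 =
      nrd p a b (g.1.2 : QuaternionAlgebra ℚ_[p] a 0 b) * quatForm a b z.2 :=
  quatForm_mulMatrix hε _ _

theorem norm_ratio_pairAct (hε : ε ^ 2 = 1) (g : quatPairs p a b)
    (z : (Fin 4 → ℚ_[p]) × (Fin 4 → ℚ_[p])) :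
    quatForm a b (pairAct ε g z).1 / quatForm a b (pairAct ε g z).2 =
      quatForm a b z.1 / quatForm a b z.2 := by
  rw [quatForm_pairAct_fst hε, quatForm_pairAct_snd hε, mul_div_mul_left _ _ (nrd_unit_ne_zero _)]

theorem pairAct_mem_tube (hε : ε ^ 2 = 1) (g : quatPairs p a b)
    (z : (Fin 4 → ℚ_[p]) × (Fin 4 → ℚ_[p])) : pairAct ε g z ∈ tube a b e ↔ z ∈ tube a b e := by
  rw [tube, Set.mem_ofPred_eq, norm_ratio_pairAct hε, quatForm_pairAct_snd hε, Set.mem_ofPred_eq,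
    mul_ne_zero_iff, and_iff_right (nrd_unit_ne_zero _)]

/-- The action leaves the ratio of the norms unchanged, and left multiplication is linear, so it
commutes with the rescaling. -/
theorem tubeProj_pairAct (hε : ε ^ 2 = 1) (he : ‖e‖ < ‖(4 : ℚ_[p])‖) (g : quatPairs p a b)
    {z : (Fin 4 → ℚ_[p]) × (Fin 4 → ℚ_[p])} (hz : z ∈ tube a b e) :
    tubeProj a b ε (pairAct ε g z) = g * tubeProj a b ε z := by
  apply pairCoords_injective hε
  rw [pairCoords_tubeProj hε he ((pairAct_mem_tube hε g z).2 hz), norm_ratio_pairAct hε]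
  have h := pairCoords_tubeProj hε he hz
  have h1 := congrArg (ofCoords a b ε) (congrArg Prod.fst h)
  have h2 := congrArg (ofCoords a b ε) (congrArg Prod.snd h)
  simp only [pairCoords] at h1 h2
  rw [ofCoords_quatCoords hε] at h1 h2
  refine Prod.ext ?_ ?_
  · show _ • Matrix.toLin' _ z.1 = quatCoords ε (_ * _)
    rw [h1, ← toLin_mulMatrix hε, map_smul]
  · show Matrix.toLin' _ z.2 = quatCoords ε (_ * _)
    rw [h2, ← toLin_mulMatrix hε]

/-- Under `g` the density changes by the factor `‖n ^ 4‖ₑ⁻¹`, where `n` is the reduced norm of `g`,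
and the Jacobian of `pairAct` compensates exactly this; tube and projection are equivariant. -/
theorem isMulLeftInvariant_tubeMeasure (hε : ε ^ 2 = 1) (he : ‖e‖ < ‖(4 : ℚ_[p])‖) :
    (tubeMeasure a b ε e).IsMulLeftInvariant := by
  refine ⟨fun g => Measure.ext fun A hA => ?_⟩
  have hgA : MeasurableSet ((g * ·) ⁻¹' A) := (measurable_const_mul g) hA
  set n := nrd p a b (g.1.2 : QuaternionAlgebra ℚ_[p] a 0 b) with hn
  have hn0 : ‖n ^ 4‖ₑ ≠ 0 := by
    rw [enorm_ne_zero]; exact pow_ne_zero 4 (nrd_unit_ne_zero _)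
  have hF : Measurable ((tube a b e ∩ tubeProj a b ε ⁻¹' A).indicator (pairDensity a b)) :=
    measurable_pairDensity.indicator ((measurableSet_tube e).inter (measurable_tubeProj hε hA))
  rw [Measure.map_apply (measurable_const_mul g) hA, tubeMeasure_apply_indicator hε hgA,
    tubeMeasure_apply_indicator hε hA]
  have key : ∀ z, (tube a b e ∩ tubeProj a b ε ⁻¹' ((g * ·) ⁻¹' A)).indicator
      (pairDensity a b) z = ‖n ^ 4‖ₑ *
        (tube a b e ∩ tubeProj a b ε ⁻¹' A).indicator (pairDensity a b) (pairAct ε g z) := by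
    intro z
    have hmem : z ∈ tube a b e ∩ tubeProj a b ε ⁻¹' ((g * ·) ⁻¹' A) ↔
        pairAct ε g z ∈ tube a b e ∩ tubeProj a b ε ⁻¹' A := by
      simp only [Set.mem_inter_iff, pairAct_mem_tube hε, Set.mem_preimage]
      refine and_congr_right fun hz => ?_
      rw [tubeProj_pairAct hε he g hz]
    by_cases hz : z ∈ tube a b e ∩ tubeProj a b ε ⁻¹' ((g * ·) ⁻¹' A)
    · rw [Set.indicator_of_mem hz, Set.indicator_of_mem (hmem.1 hz), pairDensity, pairDensity,
        quatForm_pairAct_snd hε, mul_pow, enorm_mul,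
        ENNReal.mul_inv (Or.inl hn0) (Or.inl enorm_ne_top), ← mul_assoc,
        ENNReal.mul_inv_cancel hn0 enorm_ne_top, one_mul]
    · rw [Set.indicator_of_notMem hz, Set.indicator_of_notMem (fun h => hz (hmem.2 h)), mul_zero]
  simp_rw [key]
  have hF' : Measurable fun z =>
      (tube a b e ∩ tubeProj a b ε ⁻¹' A).indicator (pairDensity a b) (pairAct ε g z) :=
    hF.comp (measurable_pairAct g)
  rw [lintegral_const_mul _ hF',
    ← lintegral_map hF (measurable_pairAct g), map_pairAct_pairHaar hε, lintegral_smul_measure,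
    smul_eq_mul, ← mul_assoc, ENNReal.mul_inv_cancel hn0 enorm_ne_top, one_mul]

end Tube

/-! ### The exact volume of a tube over a small ball of the chart. -/

section LocalFormula

variable {p : ℕ} [Fact p.Prime]

theorem norm_inv_mul_sub {s : ℚ_[p]} (hs : ‖s‖ = 1) (x : ℚ_[p]) :
    ‖s⁻¹ * x - x‖ = ‖s - 1‖ * ‖x‖ := by
  have h0 : s ≠ 0 := by rw [← norm_ne_zero_iff, hs]; exact one_ne_zero
  rw [show s⁻¹ * x - x = -(s⁻¹ * ((s - 1) * x)) by field_simp; ring, norm_neg, norm_mul, norm_inv,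
    hs, inv_one, one_mul, norm_mul]

theorem norm_inv_mul_eq {s : ℚ_[p]} (hs : ‖s‖ = 1) (x : ℚ_[p]) : ‖s⁻¹ * x‖ = ‖x‖ := by
  rw [norm_mul, norm_inv, hs, inv_one, one_mul]

/-- The effect on the last seven coordinates of rescaling the first quaternion by `s⁻¹`. -/
def rescale (s : ℚ_[p]) (y : Fin 7 → ℚ_[p]) : Fin 7 → ℚ_[p] :=
  ![s⁻¹ * y 0, s⁻¹ * y 1, s⁻¹ * y 2, y 3, y 4, y 5, y 6]

theorem norm_rescale_sub_le {s : ℚ_[p]} (hs : ‖s‖ = 1) (y : Fin 7 → ℚ_[p]) :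
    ‖rescale s y - y‖ ≤ ‖s - 1‖ * ‖y‖ := by
  have h0 : 0 ≤ ‖s - 1‖ * ‖y‖ := by positivity
  have h : ∀ i, ‖s⁻¹ * y i - y i‖ ≤ ‖s - 1‖ * ‖y‖ := fun i => by
    rw [norm_inv_mul_sub hs]
    exact mul_le_mul_of_nonneg_left (norm_le_pi_norm y i) (norm_nonneg _)
  rw [pi_norm_le_iff_of_nonneg h0]
  intro i
  fin_cases i
  exacts [h 0, h 1, h 2, by simpa [rescale] using h0, by simpa [rescale] using h0,
    by simpa [rescale] using h0, by simpa [rescale] using h0]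

theorem norm_le_norm_rescale {s : ℚ_[p]} (hs : ‖s‖ = 1) (y : Fin 7 → ℚ_[p]) :
    ‖y‖ ≤ ‖rescale s y‖ := by
  have h : ∀ i, ‖s⁻¹ * y i‖ = ‖y i‖ := fun i => norm_inv_mul_eq hs _
  rw [pi_norm_le_iff_of_nonneg (norm_nonneg _)]
  intro i
  fin_cases i
  exacts [(h 0).ge.trans (norm_le_pi_norm (rescale s y) 0),
    (h 1).ge.trans (norm_le_pi_norm (rescale s y) 1),
    (h 2).ge.trans (norm_le_pi_norm (rescale s y) 2),
    norm_le_pi_norm (rescale s y) 3, norm_le_pi_norm (rescale s y) 4,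
    norm_le_pi_norm (rescale s y) 5, norm_le_pi_norm (rescale s y) 6]

theorem mem_closedBall_iff_of_norm_sub_lt {X : Type*} [SeminormedAddCommGroup X]
    [IsUltrametricDist X] {x y z : X} {r : ℝ} (h : ‖x - y‖ ≤ r) :
    x ∈ Metric.closedBall z r ↔ y ∈ Metric.closedBall z r := by
  simp only [mem_closedBall_iff_norm]
  constructor <;> intro hx
  · rw [show y - z = (y - x) + (x - z) by abel]
    exact (IsUltrametricDist.norm_add_le_max _ _).trans (max_le (by rwa [norm_sub_rev]) hx)
  · rw [show x - z = (x - y) + (y - z) by abel]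
    exact (IsUltrametricDist.norm_add_le_max _ _).trans (max_le h hx)

theorem norm_sub_lt_iff_of_norm_sub_lt {x y z : ℚ_[p]} {r : ℝ} (h : ‖x - y‖ < r) :
    ‖x - z‖ < r ↔ ‖y - z‖ < r := by
  constructor <;> intro hx
  · rw [show y - z = (y - x) + (x - z) by ring]
    exact (IsUltrametricDist.norm_add_le_max _ _).trans_lt (max_lt (by rwa [norm_sub_rev]) hx)
  · rw [show x - z = (x - y) + (y - z) by ring]
    exact (IsUltrametricDist.norm_add_le_max _ _).trans_lt (max_lt h hx)

variable {a b ε e c n : ℚ_[p]} {y : Fin 7 → ℚ_[p]} {r M : ℝ}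

/-- In the coordinates, a thin tube over a small ball of the chart is described by
the distance of the first coordinate to the section. -/
theorem tube_inter_preimage_eq (hε : ε ^ 2 = 1) (hc : c ≠ 0)
    (hB : Metric.closedBall y r ⊆ sectionDomain a b c)
    (hn : ∀ w ∈ Metric.closedBall y r, ‖tailForm a b w‖ = ‖n‖)
    (hM : ∀ w ∈ Metric.closedBall y r, ‖w‖ ≤ M)
    (he4 : ‖e‖ < ‖(4 : ℚ_[p])‖) (heM : M * ‖e‖ ≤ r * ‖(2 : ℚ_[p])‖)
    (hen : ‖e * n / (2 * c)‖ < ‖2 * c‖) :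
    tube a b e ∩ tubeProj a b ε ⁻¹' (nearRe a b ε c ∩ pairChart ε ⁻¹' Metric.closedBall y r) =
      coordSplit ⁻¹' {w | w.2 ∈ Metric.closedBall y r ∧
        ‖w.1 - sectionRe a b c w.2‖ ≤ ‖e * n / (2 * c)‖} := by
  have hc2 : 0 < ‖2 * c‖ := norm_pos_iff.2 (mul_ne_zero two_ne_zero hc)
  have hpos2 := norm_two_pos (p := p)
  ext z
  obtain ⟨⟨t, w⟩, rfl⟩ := coordSplit.symm.surjective z
  simp only [Set.mem_inter_iff, Set.mem_preimage, ContinuousLinearEquiv.apply_symm_apply,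
    Set.mem_ofPred_eq]
  set z := coordSplit.symm (t, w) with hz
  have hzw : coordChart z = w := coordChart_coordSplit_symm t w
  have hz0 : z.1 0 = t := rfl
  set s := sqrtNear (quatForm a b z.1 / quatForm a b z.2) with hs
  have hs1 : ‖s‖ = 1 := norm_sqrtNear _
  -- the consequences of lying in the tube
  have htube : z ∈ tube a b e → ‖(2 : ℚ_[p])‖ * ‖s - 1‖ ≤ ‖e‖ := fun h => by
    rw [hs, norm_sqrtNear_sub_one (h.2.trans_lt he4)]; exact h.2
  have hre : z ∈ tube a b e → (pairCoords ε (tubeProj a b ε z)).1 0 = s⁻¹ * t := fun h => by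
    rw [pairCoords_tubeProj hε he4 h]; rfl
  have hch : z ∈ tube a b e → pairChart ε (tubeProj a b ε z) = rescale s w := fun h => by
    rw [pairChart, pairCoords_tubeProj hε he4 h]
    ext i
    fin_cases i <;> rfl
  -- Rescaling moves `w` by at most `M * ‖e‖ / ‖2‖ ≤ r`, which cannot carry a point into or out of
  -- an ultrametric ball of radius `r`.
  have hclose : z ∈ tube a b e → ‖w‖ ≤ M → ‖rescale s w - w‖ ≤ r := fun h hw => by
    refine (norm_rescale_sub_le hs1 w).trans ?_
    have h1 : ‖(2 : ℚ_[p])‖ * (‖s - 1‖ * ‖w‖) ≤ ‖(2 : ℚ_[p])‖ * r := by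
      calc ‖(2 : ℚ_[p])‖ * (‖s - 1‖ * ‖w‖) = ‖w‖ * (‖(2 : ℚ_[p])‖ * ‖s - 1‖) := by ring
        _ ≤ M * ‖e‖ := mul_le_mul hw (htube h) (by positivity) ((norm_nonneg w).trans hw)
        _ ≤ ‖(2 : ℚ_[p])‖ * r := by linarith
    exact le_of_mul_le_mul_left h1 hpos2
  have hclose0 : z ∈ tube a b e → ‖t‖ = ‖c‖ → ‖s⁻¹ * t - t‖ < ‖2 * c‖ := fun h ht => by
    rw [norm_inv_mul_sub hs1, ht, norm_mul]
    refine mul_lt_mul_of_pos_right ?_ (norm_pos_iff.2 hc)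
    refine lt_of_mul_lt_mul_left ((htube h).trans_lt ?_) hpos2.le
    rwa [← norm_four_eq]
  -- The difference of the two norms is `t ^ 2 - radicand a b w`, which factors through the section;
  -- this converts relative error of norms into distance from the section.
  have hratio : w ∈ Metric.closedBall y r → ‖t - c‖ < ‖2 * c‖ →
      ‖2 * c‖ * ‖t - sectionRe a b c w‖ =
        ‖quatForm a b z.1 / quatForm a b z.2 - 1‖ * ‖n‖ := fun hw ht => by
    have hT : tailForm a b w ≠ 0 := (hB hw).2
    rw [← norm_sq_sub_of_near ht (norm_sectionRe_sub_lt hc w), sectionRe_sq hc (hB hw),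
      ← hn w hw, ← norm_mul, quatForm_fst, quatForm_snd, hzw, hz0]
    congr 1
    field_simp
    ring
  have hen' : ‖e * n / (2 * c)‖ = ‖e‖ * ‖n‖ / ‖2 * c‖ := by rw [norm_div, norm_mul]
  constructor
  · rintro ⟨h, h1, h2⟩
    rw [hch h] at h2
    rw [nearRe, Set.mem_ofPred_eq, hre h] at h1
    -- As `‖s‖ = 1`, the size of `t` is known before `t` is known to be near `c`; `hclose0` needs
    -- only the size.
    have ht : ‖t‖ = ‖c‖ := by rw [← norm_inv_mul_eq hs1 t, norm_eq_of_near h1]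
    have ht' : ‖t - c‖ < ‖2 * c‖ := (norm_sub_lt_iff_of_norm_sub_lt (hclose0 h ht)).1 h1
    have hwM : ‖w‖ ≤ M := (norm_le_norm_rescale hs1 w).trans (hM _ h2)
    have hw : w ∈ Metric.closedBall y r := (mem_closedBall_iff_of_norm_sub_lt (hclose h hwM)).1 h2
    refine ⟨hw, ?_⟩
    rw [hen', le_div_iff₀ hc2, mul_comm, hratio hw ht']
    exact mul_le_mul_of_nonneg_right h.2 (norm_nonneg _)
  · rintro ⟨hw, ht⟩
    have ht' : ‖t - c‖ < ‖2 * c‖ :=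
      (norm_sub_lt_iff_of_norm_sub_lt (ht.trans_lt hen)).2 (norm_sectionRe_sub_lt hc w)
    have hT : tailForm a b w ≠ 0 := (hB hw).2
    have hn0 : 0 < ‖n‖ := by rw [← hn w hw]; exact norm_pos_iff.2 hT
    have h : z ∈ tube a b e := by
      refine ⟨by rwa [quatForm_snd, hzw], ?_⟩
      rw [hen', le_div_iff₀ hc2, mul_comm, hratio hw ht'] at ht
      exact le_of_mul_le_mul_right ht hn0
    refine ⟨h, ?_, ?_⟩
    · rw [nearRe, Set.mem_ofPred_eq, hre h]
      exact (norm_sub_lt_iff_of_norm_sub_lt (hclose0 h (norm_eq_of_near ht'))).2 ht'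
    · rw [hch h]
      exact (mem_closedBall_iff_of_norm_sub_lt (hclose h (hM w hw))).2 hw

theorem measurableSet_nearRe_inter (hε : ε ^ 2 = 1) :
    MeasurableSet (nearRe a b ε c ∩ pairChart ε ⁻¹' Metric.closedBall y r) :=
  (isOpen_nearRe hε c).measurableSet.inter
    ((continuous_pairChart hε).measurable Metric.isClosed_closedBall.measurableSet)

/-- The measure of the tubes over a small ball of the chart. -/
theorem tubeMeasure_chart_ball (hε : ε ^ 2 = 1) (hc : c ≠ 0) (hn0 : n ≠ 0) (he0 : e ≠ 0)
    (hB : Metric.closedBall y r ⊆ sectionDomain a b c)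
    (hn : ∀ w ∈ Metric.closedBall y r, ‖tailForm a b w‖ = ‖n‖)
    (hM : ∀ w ∈ Metric.closedBall y r, ‖w‖ ≤ M)
    (he4 : ‖e‖ < ‖(4 : ℚ_[p])‖) (heM : M * ‖e‖ ≤ r * ‖(2 : ℚ_[p])‖)
    (hen : ‖e * n / (2 * c)‖ < ‖2 * c‖) :
    tubeMeasure a b ε e (nearRe a b ε c ∩ pairChart ε ⁻¹' Metric.closedBall y r) =
      ‖e / 2‖ₑ * (‖c * n ^ 3‖ₑ⁻¹ * padicHaarPi p 7 (Metric.closedBall y r)) := by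
  have hbm : MeasurableSet (Metric.closedBall y r) := Metric.isClosed_closedBall.measurableSet
  set S : Set (ℚ_[p] × (Fin 7 → ℚ_[p])) := {w | w.2 ∈ Metric.closedBall y r ∧
    ‖w.1 - sectionRe a b c w.2‖ ≤ ‖e * n / (2 * c)‖} with hS
  have hSm : MeasurableSet S := by
    refine (measurable_snd hbm).inter ?_
    have := (continuous_sectionRe (a := a) (b := b) c).comp (continuous_snd (X := ℚ_[p]))
    exact (isClosed_le (continuous_fst.sub this).norm continuous_const).measurableSet
  rw [tubeMeasure_apply hε (measurableSet_nearRe_inter hε),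
    tube_inter_preimage_eq hε hc hB hn hM he4 heM hen]
  have hd : ∀ z ∈ coordSplit ⁻¹' S, pairDensity a b z = ‖n ^ 4‖ₑ⁻¹ := by
    intro z hz
    rw [pairDensity, quatForm_snd, ← ofReal_norm, ← ofReal_norm, norm_pow, norm_pow,
      hn (coordChart z) hz.1]
  have hSm' : MeasurableSet (coordSplit ⁻¹' S) := coordSplit.continuous.measurable hSm
  rw [setLIntegral_congr_fun hSm' hd, setLIntegral_const,
    ← Measure.map_apply coordSplit.continuous.measurable hSm, map_coordSplit_pairHaar,
    Measure.prod_apply_symm hSm]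
  have hq : e * n / (2 * c) ≠ 0 :=
    div_ne_zero (mul_ne_zero he0 hn0) (mul_ne_zero two_ne_zero hc)
  -- Each slice is a closed ball whose radius is the norm of an element, so its measure equals this
  -- radius, independently of `w`.
  have hslice : ∀ w : Fin 7 → ℚ_[p], padicHaar p ((fun t => (t, w)) ⁻¹' S) =
      (Metric.closedBall y r).indicator (fun _ => ‖e * n / (2 * c)‖ₑ) w := by
    intro w
    by_cases hw : w ∈ Metric.closedBall y r
    · rw [Set.indicator_of_mem hw, ← padicHaar_closedBall (sectionRe a b c w) hq]
      congr 1
      ext t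
      rw [mem_closedBall_iff_norm]
      exact and_iff_right hw
    · rw [Set.indicator_of_notMem hw]
      have : (fun t => (t, w)) ⁻¹' S = ∅ := by
        ext t
        simp only [hS, Set.mem_preimage, Set.mem_ofPred_eq, hw, false_and, Set.mem_empty_iff_false]
      rw [this, measure_empty]
  simp_rw [hslice]
  rw [lintegral_indicator hbm, setLIntegral_const, ← mul_assoc, ← mul_assoc]
  congr 1
  -- The density contributes `n ^ 4` in the denominator and the slice width `n` in the numerator,
  -- which leaves the exponent 3.
  rw [← enorm_inv (pow_ne_zero 4 hn0), ← enorm_inv (mul_ne_zero hc (pow_ne_zero 3 hn0)),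
    ← enorm_mul, ← enorm_mul]
  congr 1
  field_simp

end LocalFormula

/-! ### From the volumes of balls to the density of Haar measure in the chart. -/

section HaarInChart

/-- Two measures on an ultrametric space agree on a ball if they agree on all smaller balls. -/
theorem restrict_closedBall_congr {X : Type*} [PseudoMetricSpace X] [IsUltrametricDist X]
    [SecondCountableTopology X] [MeasurableSpace X] [BorelSpace X] {μ ν : Measure X} {y₀ : X}
    {r₀ : ℝ} (hr₀ : 0 < r₀) (hfin : μ (Metric.closedBall y₀ r₀) ≠ ∞)
    (h : ∀ y ∈ Metric.closedBall y₀ r₀, ∀ r, 0 < r → r ≤ r₀ →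
      μ (Metric.closedBall y r) = ν (Metric.closedBall y r)) :
    μ.restrict (Metric.closedBall y₀ r₀) = ν.restrict (Metric.closedBall y₀ r₀) := by
  have hfin' : IsFiniteMeasure (μ.restrict (Metric.closedBall y₀ r₀)) :=
    ⟨by simpa using hfin.lt_top⟩
  have hm : MeasurableSet (Metric.closedBall y₀ r₀) := Metric.isClosed_closedBall.measurableSet
  let C : Set (Set X) := {s | ∃ y r, 0 < r ∧ s = Metric.closedBall y r}
  -- Two balls that meet may be recentred at a common point, so the balls form a π-system; they are
  -- also a basis of the topology and hence generate the Borel sets.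
  have hinter : ∀ {x y z : X} {r s : ℝ}, x ∈ Metric.closedBall y r ∩ Metric.closedBall z s →
      Metric.closedBall y r ∩ Metric.closedBall z s = Metric.closedBall x (min r s) := by
    intro x y z r s hx
    rw [IsUltrametricDist.closedBall_eq_of_mem hx.1, IsUltrametricDist.closedBall_eq_of_mem hx.2]
    ext w
    simp
  have hbasis : TopologicalSpace.IsTopologicalBasis C := by
    refine TopologicalSpace.isTopologicalBasis_of_isOpen_of_nhds ?_ ?_
    · rintro _ ⟨y, r, hr, rfl⟩
      exact IsUltrametricDist.isOpen_closedBall y hr.ne'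
    · intro x U hx hU
      obtain ⟨r, hr, hrU⟩ := Metric.nhds_basis_closedBall.mem_iff.1 (hU.mem_nhds hx)
      exact ⟨_, ⟨x, r, hr, rfl⟩, Metric.mem_closedBall_self hr.le, hrU⟩
  refine ext_of_generate_finite C ?_ ?_ ?_ ?_
  · rw [‹BorelSpace X›.measurable_eq, hbasis.borel_eq_generateFrom]
  · rintro _ ⟨y, r, hr, rfl⟩ _ ⟨z, s, hs, rfl⟩ ⟨x, hx⟩
    exact ⟨x, min r s, lt_min hr hs, hinter hx⟩
  · rintro _ ⟨y, r, hr, rfl⟩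
    rw [Measure.restrict_apply' hm, Measure.restrict_apply' hm]
    rcases (Metric.closedBall y r ∩ Metric.closedBall y₀ r₀).eq_empty_or_nonempty with he | ⟨x, hx⟩
    · rw [he, measure_empty, measure_empty]
    · rw [hinter hx]
      exact h x hx.2 _ (lt_min hr hr₀) (min_le_right _ _)
  · rw [Measure.restrict_apply_univ, Measure.restrict_apply_univ]
    exact h y₀ (Metric.mem_closedBall_self hr₀.le) r₀ hr₀ le_rfl

/-- Two measures which agree locally on a set agree on this set. -/
theorem restrict_congr_of_nhds {X : Type*} [TopologicalSpace X] [SecondCountableTopology X]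
    [MeasurableSpace X] {μ ν : Measure X} {W : Set X}
    (h : ∀ x ∈ W, ∃ B ∈ 𝓝 x, μ.restrict B = ν.restrict B) : μ.restrict W = ν.restrict W := by
  choose! B hB hμν using h
  obtain ⟨t, htW, htc, hWt⟩ := TopologicalSpace.countable_cover_nhdsWithin (f := B) (s := W)
    fun x hx => mem_nhdsWithin_of_mem_nhds (hB x hx)
  exact Measure.restrict_congr_mono hWt
    ((Measure.restrict_biUnion_congr htc).2 fun x hx => hμν x (htW hx))

variable {p : ℕ} [Fact p.Prime]

/-- The balls in the domain of a branch of the inverse chart on which the norm form of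
the last four coordinates has the constant absolute value `‖n‖`. -/
structure IsChartBall (a b c n : ℚ_[p]) (y : Fin 7 → ℚ_[p]) (r : ℝ) : Prop where
  pos : 0 < r
  subset : Metric.closedBall y r ⊆ sectionDomain a b c
  norm_tailForm : ∀ w ∈ Metric.closedBall y r, ‖tailForm a b w‖ = ‖n‖

variable {a b c n ε : ℚ_[p]} {y y' : Fin 7 → ℚ_[p]} {r r' : ℝ}

theorem IsChartBall.mono (h : IsChartBall a b c n y r) (hr' : 0 < r')
    (hs : Metric.closedBall y' r' ⊆ Metric.closedBall y r) : IsChartBall a b c n y' r' :=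
  ⟨hr', hs.trans h.subset, fun w hw => h.norm_tailForm w (hs hw)⟩

theorem IsChartBall.ne_zero (h : IsChartBall a b c n y r) : n ≠ 0 := by
  have hy := Metric.mem_closedBall_self (x := y) h.pos.le
  rw [← norm_ne_zero_iff, ← h.norm_tailForm y hy, norm_ne_zero_iff]
  exact (h.subset hy).2

/-- The part of the group above a ball of the chart on a branch of the inverse chart. -/
def chartBall (a b ε c : ℚ_[p]) (y : Fin 7 → ℚ_[p]) (r : ℝ) : Set (quatPairs p a b) :=
  nearRe a b ε c ∩ pairChart ε ⁻¹' Metric.closedBall y r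

theorem chartBall_eq_image (hε : ε ^ 2 = 1) (hc : c ≠ 0) (h : IsChartBall a b c n y r) :
    chartBall a b ε c y r = chartSection a b ε c '' Metric.closedBall y r := by
  ext g
  constructor
  · rintro ⟨hg, hg'⟩
    exact ⟨_, hg', chartSection_pairChart hε hc hg⟩
  · rintro ⟨w, hw, rfl⟩
    refine ⟨chartSection_mem_nearRe hε hc (h.subset hw), ?_⟩
    rwa [Set.mem_preimage, pairChart_chartSection hε hc (h.subset hw)]

theorem isOpen_chartBall (hε : ε ^ 2 = 1) (hr : 0 < r) : IsOpen (chartBall a b ε c y r) :=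
  (isOpen_nearRe hε c).inter
    ((IsUltrametricDist.isOpen_closedBall y hr.ne').preimage (continuous_pairChart hε))

theorem isCompact_chartBall (hε : ε ^ 2 = 1) (hc : c ≠ 0) (h : IsChartBall a b c n y r) :
    IsCompact (chartBall a b ε c y r) := by
  rw [chartBall_eq_image hε hc h]
  exact (isCompact_closedBall y r).image_of_continuousOn
    ((continuousOn_chartSection hε hc).mono h.subset)

theorem nonempty_chartBall (hε : ε ^ 2 = 1) (hc : c ≠ 0) (h : IsChartBall a b c n y r) :
    (chartBall a b ε c y r).Nonempty := by
  rw [chartBall_eq_image hε hc h]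
  exact (Metric.nonempty_closedBall.2 h.pos.le).image _

/-- The smallness required of `e` depends on the ball; the filter form allows one `e` to serve two
balls at once. -/
theorem eventually_tubeMeasure_chartBall (hε : ε ^ 2 = 1) (hc : c ≠ 0)
    (h : IsChartBall a b c n y r) :
    ∀ᶠ e in 𝓝[≠] (0 : ℚ_[p]), tubeMeasure a b ε e (chartBall a b ε c y r) =
      ‖e / 2‖ₑ * (‖c * n ^ 3‖ₑ⁻¹ * padicHaarPi p 7 (Metric.closedBall y r)) := by
  have h2c : 0 < ‖2 * c‖ := norm_pos_iff.2 (mul_ne_zero two_ne_zero hc)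
  have h1 : ∀ᶠ e : ℚ_[p] in 𝓝 0, ‖e‖ < ‖(4 : ℚ_[p])‖ := by
    have : ContinuousAt (fun e : ℚ_[p] => ‖e‖) 0 := by fun_prop
    exact this.eventually_lt continuousAt_const (by rw [norm_zero, norm_pos_iff]; norm_num)
  have h2 : ∀ᶠ e : ℚ_[p] in 𝓝 0, max r ‖y‖ * ‖e‖ < r * ‖(2 : ℚ_[p])‖ := by
    have : ContinuousAt (fun e : ℚ_[p] => max r ‖y‖ * ‖e‖) 0 := by fun_prop
    exact this.eventually_lt continuousAt_const
      (by rw [norm_zero, mul_zero]; exact mul_pos h.pos norm_two_pos)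
  have h3 : ∀ᶠ e : ℚ_[p] in 𝓝 0, ‖e * n / (2 * c)‖ < ‖2 * c‖ := by
    have : ContinuousAt (fun e : ℚ_[p] => ‖e * n / (2 * c)‖) 0 := by fun_prop
    exact this.eventually_lt continuousAt_const (by simpa using h2c)
  filter_upwards [nhdsWithin_le_nhds (h1.and (h2.and h3)), self_mem_nhdsWithin] with e he he0
  refine tubeMeasure_chart_ball hε hc h.ne_zero he0 h.subset h.norm_tailForm ?_ he.1 he.2.1.le
    he.2.2
  intro w hw
  rw [mem_closedBall_iff_norm] at hw
  have := IsUltrametricDist.norm_add_le_max (w - y) y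
  rw [sub_add_cancel] at this
  exact this.trans (max_le_max hw le_rfl)

theorem padicHaarPi_closedBall_ne_zero (hr : 0 < r) :
    padicHaarPi p 7 (Metric.closedBall y r) ≠ 0 :=
  (Metric.measure_closedBall_pos _ y hr).ne'

theorem padicHaarPi_closedBall_ne_top : padicHaarPi p 7 (Metric.closedBall y r) ≠ ∞ :=
  (isCompact_closedBall y r).measure_ne_top

theorem enorm_inv_ne_top (hc : c ≠ 0) (hn : n ≠ 0) : ‖c * n ^ 3‖ₑ⁻¹ ≠ ∞ := by
  rw [ENNReal.inv_ne_top, enorm_ne_zero]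
  exact mul_ne_zero hc (pow_ne_zero 3 hn)

/-- A Haar measure on the group with the right value on one ball of the chart has the right
value on every ball of the chart. -/
theorem measure_chartBall_of_measure_chartBall (hε : ε ^ 2 = 1) {c' n' : ℚ_[p]} (hc : c ≠ 0)
    (hc' : c' ≠ 0) (h : IsChartBall a b c n y r) (h' : IsChartBall a b c' n' y' r')
    {μ : Measure (quatPairs p a b)} [LocallyCompactSpace (quatPairs p a b)] [μ.IsHaarMeasure]
    (hμ : μ (chartBall a b ε c y r) =
      ‖c * n ^ 3‖ₑ⁻¹ * padicHaarPi p 7 (Metric.closedBall y r)) :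
    μ (chartBall a b ε c' y' r') =
      ‖c' * n' ^ 3‖ₑ⁻¹ * padicHaarPi p 7 (Metric.closedBall y' r') := by
  have h4 : ∀ᶠ e : ℚ_[p] in 𝓝 0, ‖e‖ < ‖(4 : ℚ_[p])‖ := by
    have : ContinuousAt (fun e : ℚ_[p] => ‖e‖) 0 := by fun_prop
    exact this.eventually_lt continuousAt_const (by rw [norm_zero, norm_pos_iff]; norm_num)
  obtain ⟨e, ⟨⟨he, he'⟩, he4⟩, he0⟩ := (((eventually_tubeMeasure_chartBall hε hc h).and
    (eventually_tubeMeasure_chartBall hε hc' h')).and (nhdsWithin_le_nhds h4)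
      |>.and self_mem_nhdsWithin).exists
  have he2 : ‖e / 2‖ₑ ≠ 0 := by
    rw [enorm_ne_zero]; exact div_ne_zero he0 two_ne_zero
  have hν := isMulLeftInvariant_tubeMeasure (a := a) (b := b) hε he4
  set ν := tubeMeasure a b ε e
  set m := ‖c * n ^ 3‖ₑ⁻¹ * padicHaarPi p 7 (Metric.closedBall y r) with hm
  have hm0 : m ≠ 0 := mul_ne_zero (ENNReal.inv_ne_zero.2 enorm_ne_top)
    (padicHaarPi_closedBall_ne_zero h.pos)
  have hmt : m ≠ ∞ := ENNReal.mul_ne_top (enorm_inv_ne_top hc h.ne_zero)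
    padicHaarPi_closedBall_ne_top
  have hνH : ν.IsHaarMeasure := by
    refine Measure.isHaarMeasure_of_isCompact_nonempty_interior ν (chartBall a b ε c y r)
      (isCompact_chartBall hε hc h) ?_ ?_ ?_
    · rw [(isOpen_chartBall hε h.pos).interior_eq]
      exact nonempty_chartBall hε hc h
    · rw [he]; exact mul_ne_zero he2 hm0
    · rw [he]; exact ENNReal.mul_ne_top enorm_ne_top hmt
  have hs := Measure.isMulLeftInvariant_eq_smul ν μ
  set k := ν.haarScalarFactor μ
  -- The proportionality factor is read off on the first ball and cancels against the same `‖e /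
  -- 2‖ₑ` on the second.
  have hk : (k : ℝ≥0∞) = ‖e / 2‖ₑ := by
    have h1 : ν (chartBall a b ε c y r) = k * μ (chartBall a b ε c y r) := by
      conv_lhs => rw [hs]
      rfl
    rw [he, hμ] at h1
    exact ((ENNReal.mul_left_inj hm0 hmt).1 h1).symm
  have h2 : ν (chartBall a b ε c' y' r') = k * μ (chartBall a b ε c' y' r') := by
    conv_lhs => rw [hs]
    rfl
  rw [he', hk] at h2
  exact ((ENNReal.mul_right_inj he2 enorm_ne_top).1 h2).symm

/-- The density of the Haar measure of the group in the chart. -/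
def chartDensity (a b : ℚ_[p]) (y : Fin 7 → ℚ_[p]) : ℝ≥0∞ :=
  ‖padicSqrt p (radicand a b y) * tailForm a b y ^ 3‖ₑ⁻¹

theorem IsChartBall.chartDensity_eq (hc : c ≠ 0) (h : IsChartBall a b c n y r)
    {w : Fin 7 → ℚ_[p]} (hw : w ∈ Metric.closedBall y r) :
    chartDensity a b w = ‖c * n ^ 3‖ₑ⁻¹ := by
  have h1 : ‖padicSqrt p (radicand a b w)‖ = ‖c‖ := by
    rw [norm_padicSqrt (sectionRe_sq hc (h.subset hw)),
      norm_eq_of_near (norm_sectionRe_sub_lt hc w)]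
  rw [chartDensity, ← ofReal_norm, ← ofReal_norm, norm_mul, norm_mul, norm_pow, norm_pow, h1,
    h.norm_tailForm w hw]

theorem exists_isChartBall (hε : ε ^ 2 = 1) {U : Set (quatPairs p a b)} (hU : IsOpen U)
    {g : quatPairs p a b} (hg : g ∈ U) (hc : (pairCoords ε g).1 0 ≠ 0) :
    ∃ n r, IsChartBall a b ((pairCoords ε g).1 0) n (pairChart ε g) r ∧
      ∀ w ∈ Metric.closedBall (pairChart ε g) r,
        chartSection a b ε ((pairCoords ε g).1 0) w ∈ U := by
  have h1 := eventually_chartSection_mem hε hU hg hc rfl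
  have h0 := tailForm_pairChart_ne_zero hε g
  have h2 : ∀ᶠ w in 𝓝 (pairChart ε g), ‖tailForm a b w - tailForm a b (pairChart ε g)‖ <
      ‖tailForm a b (pairChart ε g)‖ := by
    have := continuous_tailForm a b
    have hcont : ContinuousAt (fun w => ‖tailForm a b w - tailForm a b (pairChart ε g)‖)
      (pairChart ε g) := by fun_prop
    exact hcont.eventually_lt continuousAt_const (by simpa using h0)
  obtain ⟨r, hr, hrs⟩ := Metric.nhds_basis_closedBall.eventually_iff.1 (h1.and h2)
  exact ⟨tailForm a b (pairChart ε g), r, ⟨hr, fun w hw => (hrs hw).1.1,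
    fun w hw => norm_eq_of_norm_sub_lt (hrs hw).2⟩, fun w hw => (hrs hw).1.2⟩

/-- A Haar measure which has the right value on the balls of the chart has the density
`chartDensity` in the chart. -/
theorem measure_inter_eq_lintegral (hε : ε ^ 2 = 1) {μ : Measure (quatPairs p a b)}
    (hμ : ∀ c n y r, c ≠ 0 → IsChartBall a b c n y r → μ (chartBall a b ε c y r) =
      ‖c * n ^ 3‖ₑ⁻¹ * padicHaarPi p 7 (Metric.closedBall y r))
    {U : Set (quatPairs p a b)} (hU : IsOpen U) (hi : Set.InjOn (pairChart ε) U)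
    {E : Set (quatPairs p a b)} (hE : MeasurableSet E) :
    μ (E ∩ U) = ∫⁻ y in pairChart ε '' (E ∩ U), chartDensity a b y ∂padicHaarPi p 7 := by
  have h0 : ∀ g ∈ U, (pairCoords ε g).1 0 ≠ 0 := fun g hg => re_ne_zero_of_injOn hε hU hi hg
  have hφ : Measurable (pairChart ε : quatPairs p a b → _) := (continuous_pairChart hε).measurable
  -- On `U` the chart is an open embedding, so it maps Borel sets to Borel sets.
  have hF : MeasurableSet (pairChart ε '' (E ∩ U)) := by
    have hemb := (isOpenEmbedding_domRestrict_pairChart hε hU h0 hi).measurableEmbedding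
    have := hemb.measurableSet_image.2 (measurable_subtype_coe hE)
    convert this using 1
    ext w
    constructor
    · rintro ⟨g, ⟨hgE, hgU⟩, rfl⟩
      exact ⟨⟨g, hgU⟩, hgE, rfl⟩
    · rintro ⟨g, hgE, rfl⟩
      exact ⟨g, ⟨hgE, g.2⟩, rfl⟩
  have hpre : pairChart ε ⁻¹' (pairChart ε '' (E ∩ U)) ∩ U = E ∩ U := by
    ext g
    constructor
    · rintro ⟨⟨g', hg', hgg'⟩, hg⟩
      rwa [← hi hg'.2 hg hgg']
    · intro hg
      exact ⟨⟨g, hg, rfl⟩, hg.2⟩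
  have hW : (Measure.map (pairChart ε) (μ.restrict U)).restrict (pairChart ε '' U) =
      ((padicHaarPi p 7).withDensity (chartDensity a b)).restrict (pairChart ε '' U) := by
    refine restrict_congr_of_nhds ?_
    rintro _ ⟨g, hg, rfl⟩
    obtain ⟨n, r₀, hB, hBU⟩ := exists_isChartBall hε hU hg (h0 g hg)
    set c := (pairCoords ε g).1 0
    have hc : c ≠ 0 := h0 g hg
    -- Within `U`, the preimage of a small ball is exactly one `chartBall`: the section takes its
    -- values in `U`, and injectivity excludes points of the other branch.
    have hval : ∀ y ∈ Metric.closedBall (pairChart ε g) r₀, ∀ r, 0 < r → r ≤ r₀ →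
        Measure.map (pairChart ε) (μ.restrict U) (Metric.closedBall y r) =
          ‖c * n ^ 3‖ₑ⁻¹ * padicHaarPi p 7 (Metric.closedBall y r) ∧
        (padicHaarPi p 7).withDensity (chartDensity a b) (Metric.closedBall y r) =
          ‖c * n ^ 3‖ₑ⁻¹ * padicHaarPi p 7 (Metric.closedBall y r) := by
      intro y hy r hr hrr
      have hm : MeasurableSet (Metric.closedBall y r) := Metric.isClosed_closedBall.measurableSet
      have hsub : Metric.closedBall y r ⊆ Metric.closedBall (pairChart ε g) r₀ := by
        rw [IsUltrametricDist.closedBall_eq_of_mem hy]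
        exact Metric.closedBall_subset_closedBall hrr
      have hB' := hB.mono hr hsub
      constructor
      · rw [← hμ c n y r hc hB', Measure.map_apply hφ hm, Measure.restrict_apply (hφ hm)]
        congr 1
        ext g'
        constructor
        · rintro ⟨hg1, hg2⟩
          have hd := hB'.subset hg1
          have heq : chartSection a b ε c (pairChart ε g') = g' :=
            hi (hBU _ (hsub hg1)) hg2 (pairChart_chartSection hε hc hd)
          refine ⟨?_, hg1⟩
          rw [← heq]
          exact chartSection_mem_nearRe hε hc hd
        · rintro ⟨hg1, hg2⟩
          refine ⟨hg2, ?_⟩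
          rw [← chartSection_pairChart hε hc hg1]
          exact hBU _ (hsub hg2)
      · rw [withDensity_apply _ hm, setLIntegral_congr_fun hm
          (fun w hw => hB'.chartDensity_eq hc hw), setLIntegral_const]
    refine ⟨_, Metric.closedBall_mem_nhds _ hB.pos, restrict_closedBall_congr hB.pos ?_ ?_⟩
    · rw [(hval _ (Metric.mem_closedBall_self hB.pos.le) r₀ hB.pos le_rfl).1]
      exact ENNReal.mul_ne_top (enorm_inv_ne_top hc hB.ne_zero) padicHaarPi_closedBall_ne_top
    · intro y hy r hr hrr
      rw [(hval y hy r hr hrr).1, (hval y hy r hr hrr).2]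
  have hsub : pairChart ε '' (E ∩ U) ⊆ pairChart ε '' U :=
    Set.image_mono Set.inter_subset_right
  calc μ (E ∩ U) = Measure.map (pairChart ε) (μ.restrict U) (pairChart ε '' (E ∩ U)) := by
        rw [Measure.map_apply hφ hF, Measure.restrict_apply (hφ hF), hpre]
    _ = (Measure.map (pairChart ε) (μ.restrict U)).restrict (pairChart ε '' U)
          (pairChart ε '' (E ∩ U)) := by
        rw [Measure.restrict_apply hF, Set.inter_eq_left.2 hsub]
    _ = (padicHaarPi p 7).withDensity (chartDensity a b) (pairChart ε '' (E ∩ U)) := by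
        rw [hW, Measure.restrict_apply hF, Set.inter_eq_left.2 hsub]
    _ = _ := withDensity_apply _ hF

end HaarInChart

/-! ### The chart around the identity and the global Haar measure. -/

section IdentityBall

variable {p : ℕ} [Fact p.Prime]

variable (a b ε : ℚ_[p]) in
/-- The elements of the group in the ball of radius `‖2‖` about the identity. -/
def identityBall : Set (quatPairs p a b) :=
  {g | pairCoords ε g ∈ Metric.ball
    ((![1, 0, 0, 0], ![1, 0, 0, 0]) : (Fin 4 → ℚ_[p]) × (Fin 4 → ℚ_[p])) ‖(2 : ℚ_[p])‖}

variable (p) in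
/-- The image of the identity in the chart. -/
def chartCenter : Fin 7 → ℚ_[p] := ![0, 0, 0, 1, 0, 0, 0]

variable {a b ε : ℚ_[p]}

theorem mem_identityBall_iff {g : quatPairs p a b} :
    g ∈ identityBall a b ε ↔
      g ∈ nearRe a b ε 1 ∧ pairChart ε g ∈ Metric.ball (chartCenter p) ‖(2 : ℚ_[p])‖ := by
  rw [identityBall, Set.mem_ofPred_eq, mem_ball_iff_norm, ← norm_coordSplit, map_sub, nearRe,
    Set.mem_ofPred_eq, mul_one, mem_ball_iff_norm]
  exact max_lt_iff

theorem one_mem_identityBall : (1 : quatPairs p a b) ∈ identityBall a b ε := by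
  have h : pairCoords ε (1 : quatPairs p a b) = (![1, 0, 0, 0], ![1, 0, 0, 0]) := by
    refine Prod.ext ?_ ?_ <;> ext i <;> fin_cases i <;> simp [pairCoords, quatCoords]
  rw [identityBall, Set.mem_ofPred_eq, h]
  exact Metric.mem_ball_self norm_two_pos

theorem isOpen_identityBall (hε : ε ^ 2 = 1) : IsOpen (identityBall a b ε) :=
  Metric.isOpen_ball.preimage (continuous_pairCoords hε)

theorem norm_mul_sq_lt {u x : ℚ_[p]} (hu : ‖u‖ ≤ 1) (hx : ‖x‖ < ‖(2 : ℚ_[p])‖) :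
    ‖u * x ^ 2‖ < ‖(4 : ℚ_[p])‖ := by
  rw [norm_mul, norm_pow, norm_four_eq, sq]
  exact (mul_le_of_le_one_left (by positivity) hu).trans_lt
    (mul_self_lt_mul_self (norm_nonneg _) hx)

theorem norm_add_lt_of_lt {x y : ℚ_[p]} {r : ℝ} (hx : ‖x‖ < r) (hy : ‖y‖ < r) :
    ‖x + y‖ < r :=
  (IsUltrametricDist.norm_add_le_max _ _).trans_lt (max_lt hx hy)

theorem norm_sub_lt_of_lt {x y : ℚ_[p]} {r : ℝ} (hx : ‖x‖ < r) (hy : ‖y‖ < r) :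
    ‖x - y‖ < r := by
  rw [sub_eq_add_neg]
  exact norm_add_lt_of_lt hx (by rwa [norm_neg])

/-- This is where the radius `‖2‖` comes from: squares of coordinates smaller than `‖2‖` are smaller
than `‖4‖`, and `y 3 ^ 2 - 1` has norm `‖2‖ * ‖y 3 - 1‖`. The radicand thus meets the Hensel
condition on the whole ball. -/
theorem norm_sub_lt_four (ha : ‖a‖ ≤ 1) (hb : ‖b‖ ≤ 1) {y : Fin 7 → ℚ_[p]}
    (hy : y ∈ Metric.ball (chartCenter p) ‖(2 : ℚ_[p])‖) :
    ‖tailForm a b y - 1‖ < ‖(4 : ℚ_[p])‖ ∧ ‖radicand a b y - 1‖ < ‖(4 : ℚ_[p])‖ := by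
  rw [mem_ball_iff_norm, pi_norm_lt_iff norm_two_pos] at hy
  have hab : ‖a * b‖ ≤ 1 := by
    rw [norm_mul]; exact mul_le_one₀ ha (norm_nonneg _) hb
  have h0 : ‖y 0‖ < ‖(2 : ℚ_[p])‖ := by simpa [chartCenter] using hy 0
  have h1 : ‖y 1‖ < ‖(2 : ℚ_[p])‖ := by simpa [chartCenter] using hy 1
  have h2 : ‖y 2‖ < ‖(2 : ℚ_[p])‖ := by simpa [chartCenter] using hy 2
  have h3 : ‖y 3 - 1‖ < ‖(2 : ℚ_[p])‖ := by simpa [chartCenter] using hy 3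
  have h4 : ‖y 4‖ < ‖(2 : ℚ_[p])‖ := by simpa [chartCenter] using hy 4
  have h5 : ‖y 5‖ < ‖(2 : ℚ_[p])‖ := by simpa [chartCenter] using hy 5
  have h6 : ‖y 6‖ < ‖(2 : ℚ_[p])‖ := by simpa [chartCenter] using hy 6
  have h3' : ‖y 3 ^ 2 - 1‖ < ‖(4 : ℚ_[p])‖ := by
    have := norm_sq_sub_of_near (c := (1 : ℚ_[p])) (x := y 3) (y := 1) (by simpa using h3)
      (by simp)
    rw [one_pow, mul_one] at this
    rw [this, norm_four_eq]
    exact mul_lt_mul_of_pos_left h3 norm_two_pos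
  have hT : ‖tailForm a b y - 1‖ < ‖(4 : ℚ_[p])‖ := by
    have e : tailForm a b y - 1 =
        y 3 ^ 2 - 1 - a * y 4 ^ 2 - b * y 5 ^ 2 + a * b * y 6 ^ 2 := by
      simp only [tailForm, quatForm, Matrix.cons_val]; ring
    rw [e]
    exact norm_add_lt_of_lt (norm_sub_lt_of_lt (norm_sub_lt_of_lt h3' (norm_mul_sq_lt ha h4))
      (norm_mul_sq_lt hb h5)) (norm_mul_sq_lt hab h6)
  refine ⟨hT, ?_⟩
  have e : radicand a b y - 1 =
      tailForm a b y - 1 + a * y 0 ^ 2 + b * y 1 ^ 2 - a * b * y 2 ^ 2 := by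
    rw [radicand]; ring
  rw [e]
  exact norm_sub_lt_of_lt (norm_add_lt_of_lt (norm_add_lt_of_lt hT (norm_mul_sq_lt ha h0))
    (norm_mul_sq_lt hb h1)) (norm_mul_sq_lt hab h2)

theorem norm_tailForm_eq_one (ha : ‖a‖ ≤ 1) (hb : ‖b‖ ≤ 1) {y : Fin 7 → ℚ_[p]}
    (hy : y ∈ Metric.ball (chartCenter p) ‖(2 : ℚ_[p])‖) : ‖tailForm a b y‖ = 1 := by
  rw [← norm_one (α := ℚ_[p])]
  apply norm_eq_of_norm_sub_lt
  rw [norm_one]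
  exact (norm_sub_lt_four ha hb hy).1.trans_le (norm_four_le_norm_two.trans norm_two_le_one)

theorem ball_subset_sectionDomain (ha : ‖a‖ ≤ 1) (hb : ‖b‖ ≤ 1) :
    Metric.ball (chartCenter p) ‖(2 : ℚ_[p])‖ ⊆ sectionDomain a b 1 := by
  intro y hy
  refine ⟨by simpa using (norm_sub_lt_four ha hb hy).2, ?_⟩
  rw [← norm_ne_zero_iff, norm_tailForm_eq_one ha hb hy]
  exact one_ne_zero

theorem re_ne_zero_of_mem_nearRe {c : ℚ_[p]} (hc : c ≠ 0) {g : quatPairs p a b}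
    (hg : g ∈ nearRe a b ε c) : (pairCoords ε g).1 0 ≠ 0 := by
  rw [← norm_ne_zero_iff, norm_eq_of_near hg, norm_ne_zero_iff]
  exact hc

theorem injOn_pairChart_nearRe (hε : ε ^ 2 = 1) {c : ℚ_[p]} (hc : c ≠ 0) :
    Set.InjOn (pairChart ε) (nearRe a b ε c) := by
  intro g hg h hh hgh
  rw [← chartSection_pairChart hε hc hg, hgh, chartSection_pairChart hε hc hh]

/-- The ball about the identity is a chart domain. -/
theorem identityBall_isChartDomain (hε : ε ^ 2 = 1) (ha : ‖a‖ ≤ 1) (hb : ‖b‖ ≤ 1) :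
    IsOpen (identityBall a b ε) ∧ 1 ∈ identityBall a b ε ∧
      IsOpenEmbedding ((identityBall a b ε).domRestrict (pairChart ε)) ∧
      pairChart ε '' identityBall a b ε = Metric.ball (chartCenter p) ‖(2 : ℚ_[p])‖ ∧
      ∀ g ∈ identityBall a b ε, IsSquare (radicand a b (pairChart ε g)) ∧
        ((pairCoords ε g).1 0 = padicSqrt p (radicand a b (pairChart ε g)) ∨
          (pairCoords ε g).1 0 = -padicSqrt p (radicand a b (pairChart ε g))) := by
  have hsub : identityBall a b ε ⊆ nearRe a b ε 1 := fun g hg => (mem_identityBall_iff.1 hg).1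
  refine ⟨isOpen_identityBall hε, one_mem_identityBall, ?_, ?_, ?_⟩
  · exact isOpenEmbedding_domRestrict_pairChart hε (isOpen_identityBall hε)
      (fun g hg => re_ne_zero_of_mem_nearRe one_ne_zero (hsub hg))
      ((injOn_pairChart_nearRe hε one_ne_zero).mono hsub)
  · ext y
    constructor
    · rintro ⟨g, hg, rfl⟩
      exact (mem_identityBall_iff.1 hg).2
    · intro hy
      have hd := ball_subset_sectionDomain ha hb hy
      have h := pairChart_chartSection hε one_ne_zero hd
      refine ⟨_, mem_identityBall_iff.2 ⟨chartSection_mem_nearRe hε one_ne_zero hd, ?_⟩, h⟩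
      rwa [h]
  · intro g _
    exact eq_or_eq_neg_padicSqrt (re_sq_eq_radicand hε g)

/-- A closed ball of the chart about the identity. -/
theorem isChartBall_chartCenter (ha : ‖a‖ ≤ 1) (hb : ‖b‖ ≤ 1) :
    IsChartBall a b 1 1 (chartCenter p) (‖(2 : ℚ_[p])‖ / 2) := by
  have hsub : Metric.closedBall (chartCenter p) (‖(2 : ℚ_[p])‖ / 2) ⊆
      Metric.ball (chartCenter p) ‖(2 : ℚ_[p])‖ :=
    Metric.closedBall_subset_ball (half_lt_self norm_two_pos)
  refine ⟨half_pos norm_two_pos, hsub.trans (ball_subset_sectionDomain ha hb), fun w hw => ?_⟩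
  rw [norm_tailForm_eq_one ha hb (hsub hw), norm_one]

/-- There is a Haar measure with the density `chartDensity` in the chart, and it is unique up to
a constant. -/
theorem exists_haar_chartDensity (hε : ε ^ 2 = 1) (ha : ‖a‖ ≤ 1) (hb : ‖b‖ ≤ 1) :
    ∃ μ : Measure (quatPairs p a b), μ.IsHaarMeasure ∧
      (∀ ν : Measure (quatPairs p a b), ν.IsHaarMeasure → ∃ c : NNReal, 0 < c ∧ ν = c • μ) ∧
      ∀ U : Set (quatPairs p a b), IsOpen U → Set.InjOn (pairChart ε) U →
        ∀ E : Set (quatPairs p a b), MeasurableSet E →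
          μ (E ∩ U) = ∫⁻ y in pairChart ε '' (E ∩ U), chartDensity a b y ∂padicHaarPi p 7 := by
  have h1 := isChartBall_chartCenter ha hb
  set y := chartCenter p
  set r := ‖(2 : ℚ_[p])‖ / 2
  have hopen := isOpen_chartBall (a := a) (b := b) (c := 1) (y := y) hε h1.pos
  have hne := nonempty_chartBall hε one_ne_zero h1
  let K : TopologicalSpace.PositiveCompacts (quatPairs p a b) :=
    { carrier := chartBall a b ε 1 y r
      isCompact' := isCompact_chartBall hε one_ne_zero h1
      interior_nonempty' := by rwa [hopen.interior_eq] }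
  -- One compact set with nonempty interior makes the whole group locally compact.
  have hlc : LocallyCompactSpace (quatPairs p a b) :=
    TopologicalSpace.PositiveCompacts.locallyCompactSpace_of_group K
  have hm0 : padicHaarPi p 7 (Metric.closedBall y r) ≠ 0 := padicHaarPi_closedBall_ne_zero h1.pos
  have hH : (padicHaarPi p 7 (Metric.closedBall y r) • Measure.haarMeasure K).IsHaarMeasure :=
    Measure.IsHaarMeasure.smul _ hm0 padicHaarPi_closedBall_ne_top
  -- The normalization makes the formula true on this first ball, where the density is 1.
  set μ := padicHaarPi p 7 (Metric.closedBall y r) • Measure.haarMeasure K with hμ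
  have hK : μ (chartBall a b ε 1 y r) =
      ‖(1 : ℚ_[p]) * 1 ^ 3‖ₑ⁻¹ * padicHaarPi p 7 (Metric.closedBall y r) := by
    have h : Measure.haarMeasure K (chartBall a b ε 1 y r) = 1 := Measure.haarMeasure_self
    rw [hμ, Measure.smul_apply, h]
    simp
  refine ⟨μ, hH, fun ν hν => ?_, fun U hU hi E hE => ?_⟩
  · exact ⟨_, Measure.haarScalarFactor_pos_of_isHaarMeasure ν μ,
      Measure.isMulLeftInvariant_eq_smul ν μ⟩
  · refine measure_inter_eq_lintegral hε (fun c n y' r' hc h => ?_) hU hi hE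
    exact measure_chartBall_of_measure_chartBall hε one_ne_zero hc h1 h hK

end IdentityBall

/-! ### The cases `p > 2` and `p = 2` as instances of the general setting. -/

section Specialization

variable (p : ℕ) [Fact p.Prime] (v : ℚ_[p])

theorem oddCoords_eq : oddCoords p v = quatCoords (-1) := by
  ext x i; fin_cases i <;> simp [oddCoords, quatCoords]

theorem oddForm_eq : oddForm p v = quatForm v (-(p : ℚ_[p])) := by
  ext q; simp only [oddForm, quatForm]; ring

theorem oddChart_eq : oddChart p v = pairChart (-1) := by
  ext1 g
  simp only [oddChart, oddCoords_eq]
  rfl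

theorem oddRadicand_eq : oddRadicand p v = radicand v (-(p : ℚ_[p])) := by
  ext y
  simp only [oddRadicand, radicand, tailForm, oddForm_eq]
  ring

theorem norm_two_of_two_lt (hp : 2 < p) : ‖(2 : ℚ_[p])‖ = 1 := by
  refine le_antisymm norm_two_le_one (not_lt.1 fun h => ?_)
  have h2 : ‖((2 : ℤ) : ℚ_[p])‖ < 1 := by exact_mod_cast h
  rw [Padic.norm_intCast_lt_one_iff] at h2
  have := Int.le_of_dvd two_pos h2
  omega

theorem oddBall_eq (hp : 2 < p) : oddBall p v = identityBall v (-(p : ℚ_[p])) (-1) := by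
  rw [identityBall, norm_two_of_two_lt p hp, oddBall, oddCoords_eq]
  rfl

theorem twoCoords_eq : twoCoords = quatCoords 1 := by
  ext x i; fin_cases i <;> simp [twoCoords, quatCoords]

theorem twoForm_eq : twoForm = quatForm (-1) (-1) := by
  ext q; simp only [twoForm, quatForm]; ring

theorem twoChart_eq : twoChart = pairChart 1 := by
  ext1 g
  simp only [twoChart, twoCoords_eq]
  rfl

theorem twoRadicand_eq : twoRadicand = radicand (-1) (-1) := by
  ext y
  simp only [twoRadicand, radicand, tailForm, twoForm_eq]
  ring

theorem norm_two_padic_two : ‖(2 : ℚ_[2])‖ = 1 / 2 := by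
  have := Padic.norm_p (p := 2)
  norm_num at this ⊢
  exact this

theorem twoBall_eq : twoBall = identityBall (-1) (-1) 1 := by
  rw [identityBall, norm_two_padic_two, twoBall, twoCoords_eq]
  rfl

end Specialization

end PadicQuat

end

theorem mainTheorem10 :
    (∀ (p : ℕ) [Fact p.Prime] (v : ℚ_[p]), 2 < p → ‖v‖ = 1 → ¬ IsSquare v →
      -- the ball of radius 1 about the identity is a chart domain, with `c₀` a square root
      (IsOpen (oddBall p v) ∧ 1 ∈ oddBall p v ∧
        IsOpenEmbedding ((oddBall p v).domRestrict (oddChart p v)) ∧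
        oddChart p v '' oddBall p v = Metric.ball ![0, 0, 0, 1, 0, 0, 0] 1 ∧
        ∀ g ∈ oddBall p v,
          IsSquare (oddRadicand p v (oddChart p v g)) ∧
          (oddCoords p v g.1.1 0 = padicSqrt p (oddRadicand p v (oddChart p v g)) ∨
            oddCoords p v g.1.1 0 = -padicSqrt p (oddRadicand p v (oddChart p v g)))) ∧
      -- the Haar measure, unique up to a constant, in the coordinates
      ∃ μ : Measure (OddPairs p v), μ.IsHaarMeasure ∧
        (∀ ν : Measure (OddPairs p v), ν.IsHaarMeasure →
          ∃ c : NNReal, 0 < c ∧ ν = c • μ) ∧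
        ∀ U : Set (OddPairs p v), IsOpen U → 1 ∈ U → Set.InjOn (oddChart p v) U →
          ∀ E : Set (OddPairs p v), MeasurableSet E →
            μ (E ∩ U) = ∫⁻ y in oddChart p v '' (E ∩ U),
              ‖padicSqrt p (oddRadicand p v y) *
                oddForm p v ![y 3, y 4, y 5, y 6] ^ 3‖ₑ⁻¹ ∂(padicHaarPi p 7)) ∧
    ((IsOpen twoBall ∧ 1 ∈ twoBall ∧
        IsOpenEmbedding (twoBall.domRestrict twoChart) ∧
        twoChart '' twoBall = Metric.ball ![0, 0, 0, 1, 0, 0, 0] (1 / 2) ∧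
        ∀ g ∈ twoBall,
          IsSquare (twoRadicand (twoChart g)) ∧
          (twoCoords g.1.1 0 = padicSqrt 2 (twoRadicand (twoChart g)) ∨
            twoCoords g.1.1 0 = -padicSqrt 2 (twoRadicand (twoChart g)))) ∧
      ∃ μ : Measure TwoPairs, μ.IsHaarMeasure ∧
        (∀ ν : Measure TwoPairs, ν.IsHaarMeasure → ∃ c : NNReal, 0 < c ∧ ν = c • μ) ∧
        ∀ U : Set TwoPairs, IsOpen U → 1 ∈ U → Set.InjOn twoChart U →
          ∀ E : Set TwoPairs, MeasurableSet E →
            μ (E ∩ U) = ∫⁻ y in twoChart '' (E ∩ U),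
              ‖padicSqrt 2 (twoRadicand y) * twoForm ![y 3, y 4, y 5, y 6] ^ 3‖ₑ⁻¹
                ∂(padicHaarPi 2 7)) := by
  refine ⟨fun p _ v hp hv _ => ⟨?_, ?_⟩, ?_, ?_⟩
  -- The sign is -1 because k = ji = -ij for `p > 2`.
  · have h := identityBall_isChartDomain (p := p) (ε := -1) (a := v) (b := -(p : ℚ_[p])) (by ring)
      hv.le (by rw [norm_neg]; exact (Padic.norm_p_lt_one).le)
    rw [oddBall_eq p v hp, oddRadicand_eq, oddChart_eq, oddCoords_eq]
    rw [norm_two_of_two_lt p hp] at h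
    exact h
  · obtain ⟨μ, h1, h2, h3⟩ := exists_haar_chartDensity (p := p) (ε := -1) (a := v)
      (b := -(p : ℚ_[p])) (by ring) hv.le (by rw [norm_neg]; exact (Padic.norm_p_lt_one).le)
    refine ⟨μ, h1, h2, fun U hU _ hi E hE => ?_⟩
    rw [oddChart_eq] at hi ⊢
    rw [oddRadicand_eq, oddForm_eq]
    exact h3 U hU hi E hE
  · have h := identityBall_isChartDomain (p := 2) (ε := 1) (a := -1) (b := -1) (by ring)
      (by simp) (by simp)
    rw [twoBall_eq, twoRadicand_eq, twoChart_eq, twoCoords_eq]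
    rw [norm_two_padic_two] at h
    exact h
  · obtain ⟨μ, h1, h2, h3⟩ := exists_haar_chartDensity (p := 2) (ε := 1) (a := -1) (b := -1)
      (by ring) (by simp) (by simp)
    refine ⟨μ, h1, h2, fun U hU _ hi E hE => ?_⟩
    rw [twoChart_eq] at hi ⊢
    rw [twoRadicand_eq, twoForm_eq]
    exact h3 U hU hi E hE
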